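/- Let $d\ge 0$ and let $A=\mathbb Z[x_1,\dots,x_d]/\mathfrak m^2$ with $\mathfrak m=(x_1,\dots,x_d)$. The periodic cyclic homology of $A$ over $\mathbb Z$ is the homology of the (direct product) total complex of the upper half-plane bicomplex with entry $A^{\otimes (q+1)}$ in column $p\in\mathbb Z$ and row $q\ge 0$, whose even columns are the Hochschild complex $(A^{\otimes *+1},b)$, whose odd columns are the bar complex $(A^{\otimes *+1},b')$, and whose horizontal maps are $1-t$ from odd to even columns and $N=1+t+\dots+t^{q}$ from even to odd columns, where $t(a_0\otimes\cdots\otimes a_q)=(-1)^q\,a_q\otimes a_0\otimes\cdots\otimes a_{q-1}$; as usual the vertical maps in the odd columns are taken with a minus sign in the total complex. For $w\ge 0$ let $HP^{(w)}_*(A)$ be the homology of the subcomplex of weight $w$, i.e. of the total complex of the sub-bicomplex whose entries are spanned by the tensor monomials $m_0\otimes\cdots\otimes m_q$ that contain $w$ factors $x_j$ in total. For $m\ge 1$ let $\omega_{m,d}$ be the set of all cycle families of words of length $m$ and cycle length $m$ in $x_1,\dots,x_d$; here the cycle length of a word is the least $r>0$ such that rotating the word $r$ times fixes it, and its cycle family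 is the set of all its rotations. Then $$HP^{(0)}_n(A)\cong\begin{cases}\mathbb Z & n \text{ even}\\ 0 & n\text{ odd,}\end{cases}$$ and for every $w>0$ and every $i\in\mathbb Z$ $$HP^{(w)}_{w+2i}(A)\cong\bigoplus_{\substack{m\mid w\\ m\equiv w\ (2)}}\ \bigoplus_{\omega_{m,d}}\mathbb Z/\big(\tfrac wm\big),\qquad HP^{(w)}_{w+1+2i}(A)\cong\bigoplus_{\substack{m\mid w\\ m\not\equiv w\ (2)}}\ \bigoplus_{\omega_{m,d}}\mathbb Z/2 .$$ Moreover, for every $m\ge1$ the set $\omega_{m,d}$ is finite and has $\frac1m\sum_{i\mid m}\mu(m/i)\,d^{i}$ elements, where $\mu$ is the Möbius function. -/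

import Mathlib

open scoped TensorProduct DirectSum

noncomputable section

namespace CyclicHomology

/-! ### The periodic cyclic bicomplex of a `k`-algebra

The module `A^{⊗ (n+1)}` is `⨂[k]^(n+1) A`, with tensor factors indexed by `Fin (n+1)`. -/

section Bicomplex

/-- In `a ↦ (a₀, …, aᵢ aᵢ₊₁, …, aₙ₊₁)`, changing the entry `aᵢ₊₁` changes the `i`-th entry. -/
theorem contractNth_update_succ {A : Type*} [Mul A] (n : ℕ) (i : Fin (n + 1))
    (a : Fin (n + 2) → A) (x : A) :
    i.castSucc.contractNth (· * ·) (Function.update a i.succ x) =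
      Function.update (i.castSucc.contractNth (· * ·) a) i (a i.castSucc * x) := by
  funext k
  rcases lt_trichotomy k i with h | rfl | h
  · have h1 : (k : ℕ) < i := h
    rw [Function.update_of_ne h.ne, Fin.contractNth_apply_of_lt _ _ _ _ (by simpa using h1),
      Fin.contractNth_apply_of_lt _ _ _ _ (by simpa using h1), Function.update_of_ne]
    intro h2
    have := congrArg Fin.val h2
    simp at this
    omega
  · rw [Function.update_self, Fin.contractNth_apply_of_eq _ _ _ _ (by simp), Function.update_self,
      Function.update_of_ne]
    intro h2
    have := congrArg Fin.val h2
    simp at this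
  · have h1 : (i : ℕ) < k := h
    rw [Function.update_of_ne h.ne', Fin.contractNth_apply_of_gt _ _ _ _ (by simpa using h1),
      Fin.contractNth_apply_of_gt _ _ _ _ (by simpa using h1), Function.update_of_ne]
    intro h2
    have := congrArg Fin.val h2
    simp at this
    omega

/-- In `a ↦ (a₀, …, aᵢ aᵢ₊₁, …, aₙ₊₁)`, changing an entry other than `aᵢ₊₁` changes one entry. -/
theorem contractNth_update_succAbove {A : Type*} [Monoid A] (n : ℕ) (i j : Fin (n + 1))
    (a : Fin (n + 2) → A) (x : A) :
    i.castSucc.contractNth (· * ·) (Function.update a (i.succ.succAbove j) x) =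
      Function.update (i.castSucc.contractNth (· * ·) a) j
        (x * if j = i then a i.succ else 1) := by
  funext k
  have key : ∀ (b : Fin (n + 2) → A) (l : Fin (n + 1)), i.castSucc.contractNth (· * ·) b l =
      b (i.succ.succAbove l) * if l = i then b i.succ else 1 := by
    intro b l
    rcases lt_trichotomy l i with h | rfl | h
    · have h1 : (l : ℕ) < i := h
      rw [Fin.contractNth_apply_of_lt _ _ _ _ (by simpa using h1), if_neg h.ne, mul_one,
        Fin.succAbove_of_castSucc_lt]
      rw [Fin.lt_def]; simp; omega
    · rw [Fin.contractNth_apply_of_eq _ _ _ _ (by simp), if_pos rfl,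
        Fin.succAbove_of_castSucc_lt]
      rw [Fin.lt_def]; simp
    · have h1 : (i : ℕ) < l := h
      rw [Fin.contractNth_apply_of_gt _ _ _ _ (by simpa using h1), if_neg h.ne', mul_one,
        Fin.succAbove_of_le_castSucc]
      rw [Fin.le_def]; simp; omega
  rw [key]
  by_cases hk : k = j
  · subst hk
    rw [Function.update_self, Function.update_self,
      Function.update_of_ne (Fin.succAbove_ne _ _).symm]
  · rw [Function.update_of_ne hk, Function.update_of_ne (Fin.succAbove_ne _ _).symm,
      Function.update_of_ne (fun h => hk (Fin.succAbove_right_injective h)), key]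

variable (k A : Type*) [CommRing k] [Ring A] [Algebra k A]

/-- The face map `dᵢ(a₀ ⊗ ⋯ ⊗ aₙ₊₁) = a₀ ⊗ ⋯ ⊗ aᵢ aᵢ₊₁ ⊗ ⋯ ⊗ aₙ₊₁`, for `0 ≤ i ≤ n`. -/
def face (n : ℕ) (i : Fin (n + 1)) : (⨂[k]^(n + 2) A) →ₗ[k] (⨂[k]^(n + 1) A) :=
  PiTensorProduct.lift
    { toFun := fun a => PiTensorProduct.tprod k (i.castSucc.contractNth (· * ·) a)
      map_update_add' := by
        intro inst a j x y
        rw [Subsingleton.elim inst (instDecidableEqFin _)]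
        rcases Fin.eq_self_or_eq_succAbove i.succ j with rfl | ⟨l, rfl⟩
        · simp only [contractNth_update_succ, mul_add, MultilinearMap.map_update_add]
        · simp only [contractNth_update_succAbove, add_mul, MultilinearMap.map_update_add]
      map_update_smul' := by
        intro inst a j c x
        rw [Subsingleton.elim inst (instDecidableEqFin _)]
        rcases Fin.eq_self_or_eq_succAbove i.succ j with rfl | ⟨l, rfl⟩
        · simp only [contractNth_update_succ, mul_smul_comm, MultilinearMap.map_update_smul]
        · simp only [contractNth_update_succAbove, smul_mul_assoc,
            MultilinearMap.map_update_smul] }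

@[simp]
theorem face_tprod (n : ℕ) (i : Fin (n + 1)) (a : Fin (n + 2) → A) :
    face k A n i (PiTensorProduct.tprod k a) =
      PiTensorProduct.tprod k (i.castSucc.contractNth (· * ·) a) :=
  PiTensorProduct.lift.tprod _

/-- The unsigned rotation `a₀ ⊗ a₁ ⊗ ⋯ ⊗ aₙ ↦ aₙ ⊗ a₀ ⊗ ⋯ ⊗ aₙ₋₁`. -/
def rot (n : ℕ) : (⨂[k]^(n + 1) A) →ₗ[k] (⨂[k]^(n + 1) A) :=
  (PiTensorProduct.reindex k (fun _ => A) (finRotate (n + 1))).toLinearMap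

@[simp]
theorem rot_tprod (n : ℕ) (a : Fin (n + 1) → A) :
    rot k A n (PiTensorProduct.tprod k a) =
      PiTensorProduct.tprod k (fun i => a ((finRotate (n + 1)).symm i)) :=
  PiTensorProduct.reindex_tprod _ _

/-- The last face map `dₙ₊₁(a₀ ⊗ ⋯ ⊗ aₙ₊₁) = aₙ₊₁ a₀ ⊗ a₁ ⊗ ⋯ ⊗ aₙ`: first rotate, then multiply
the first two entries. -/
def lastFace (n : ℕ) : (⨂[k]^(n + 2) A) →ₗ[k] (⨂[k]^(n + 1) A) :=
  face k A n 0 ∘ₗ rot k A (n + 1)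

/-- `b'(a₀ ⊗ ⋯ ⊗ aₙ₊₁) = ∑_{i=0}^{n} (-1)ⁱ dᵢ(a₀ ⊗ ⋯ ⊗ aₙ₊₁)`, the bar differential. -/
def bPrime (n : ℕ) : (⨂[k]^(n + 2) A) →ₗ[k] (⨂[k]^(n + 1) A) :=
  ∑ i : Fin (n + 1), (-1 : k) ^ (i : ℕ) • face k A n i

/-- `b(a₀ ⊗ ⋯ ⊗ aₙ₊₁) = ∑_{i=0}^{n+1} (-1)ⁱ dᵢ(a₀ ⊗ ⋯ ⊗ aₙ₊₁)`, the Hochschild differential. -/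
def b (n : ℕ) : (⨂[k]^(n + 2) A) →ₗ[k] (⨂[k]^(n + 1) A) :=
  bPrime k A n + (-1 : k) ^ (n + 1) • lastFace k A n

/-- `tₙ(a₀ ⊗ ⋯ ⊗ aₙ) = (-1)ⁿ aₙ ⊗ a₀ ⊗ ⋯ ⊗ aₙ₋₁`. -/
def t (n : ℕ) : (⨂[k]^(n + 1) A) →ₗ[k] (⨂[k]^(n + 1) A) :=
  (-1 : k) ^ n • rot k A n

/-- `Nₙ = 1 + tₙ + ⋯ + tₙⁿ`. -/
def N (n : ℕ) : (⨂[k]^(n + 1) A) →ₗ[k] (⨂[k]^(n + 1) A) :=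
  ∑ i ∈ Finset.range (n + 1), t k A n ^ i

/-- The vertical differential of the bicomplex, in column `p`, from row `q + 1` to row `q`:
`b` in the even columns and `-b'` in the odd ones. (The squares of the bicomplex with columns `b`
and `b'` commute; the sign `(-1)ᵖ` makes them anticommute, so that there is a total complex.) -/
def vert (p : ℤ) (q : ℕ) : (⨂[k]^(q + 2) A) →ₗ[k] (⨂[k]^(q + 1) A) :=
  if Even p then b k A q else -bPrime k A q

/-- The horizontal differential of the bicomplex, in row `q`, from column `p` to column `p - 1`:
`N` if `p` is even and `1 - t` if `p` is odd. -/
def horiz (p : ℤ) (q : ℕ) : (⨂[k]^(q + 1) A) →ₗ[k] (⨂[k]^(q + 1) A) :=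
  if Even p then N k A q else 1 - t k A q

/-- The total object of the periodic bicomplex in a degree `n : ℤ`: the product over the rows
`q ≥ 0` of the entry `A^{⊗ (q+1)}` in column `n - q`. -/
abbrev Tot : Type _ := (q : ℕ) → ⨂[k]^(q + 1) A

/-- The total differential from degree `n` to degree `n - 1`. -/
def D (n : ℤ) : Tot k A →ₗ[k] Tot k A :=
  LinearMap.pi fun q =>
    vert k A (n - (q + 1)) q ∘ₗ LinearMap.proj (q + 1) + horiz k A (n - q) q ∘ₗ LinearMap.proj q

theorem D_apply (n : ℤ) (c : Tot k A) (q : ℕ) :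
    D k A n c q = vert k A (n - (q + 1)) q (c (q + 1)) + horiz k A (n - q) q (c q) :=
  rfl

/-- `dᵢ dⱼ₊₁ = dⱼ dᵢ` for `i ≤ j`. -/
theorem face_face (n : ℕ) (i j : Fin (n + 1)) (h : i ≤ j) :
    face k A n i ∘ₗ face k A (n + 1) j.succ = face k A n j ∘ₗ face k A (n + 1) i.castSucc := by
  refine PiTensorProduct.ext (MultilinearMap.ext fun a => ?_)
  simp only [LinearMap.compMultilinearMap_apply, LinearMap.comp_apply, face_tprod]
  congr 1
  funext l
  have h' : (i : ℕ) ≤ j := h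
  simp only [Fin.contractNth, Fin.val_castSucc, Fin.val_succ]
  split_ifs <;> first | rfl | omega | simp [mul_assoc]

theorem finRotate_symm_zero (n : ℕ) : (finRotate (n + 1)).symm 0 = Fin.last n := by
  rw [Equiv.symm_apply_eq, finRotate_last]

theorem finRotate_symm_succ (n : ℕ) (l : Fin n) :
    (finRotate (n + 1)).symm l.succ = l.castSucc := by
  rw [Equiv.symm_apply_eq, finRotate_apply]
  simp

/-- `dᵢ₊₁ τ = τ dᵢ` for the unsigned rotation `τ`. -/
theorem face_rot (n : ℕ) (i : Fin n) :
    face k A n i.succ ∘ₗ rot k A (n + 1) = rot k A n ∘ₗ face k A n i.castSucc := by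
  refine PiTensorProduct.ext (MultilinearMap.ext fun a => ?_)
  simp only [LinearMap.compMultilinearMap_apply, LinearMap.comp_apply, face_tprod, rot_tprod]
  congr 1
  funext l
  have hi := i.isLt
  refine Fin.cases ?_ (fun l => ?_) l
  · rw [finRotate_symm_zero, Fin.contractNth_apply_of_lt _ _ _ _ (by simp),
      Fin.contractNth_apply_of_gt _ _ _ _ (by simp), Fin.castSucc_zero, finRotate_symm_zero]
    rfl
  · simp only [finRotate_symm_succ, Fin.contractNth, Fin.val_castSucc, Fin.val_succ,
      Nat.add_lt_add_iff_right, Nat.add_right_cancel_iff]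
    simp only [← Fin.succ_castSucc, finRotate_symm_succ]

/-- `d₀ τ² = τ dₙ` for the unsigned rotation `τ`. -/
theorem face_rot_rot (n : ℕ) :
    face k A n 0 ∘ₗ rot k A (n + 1) ∘ₗ rot k A (n + 1) =
      rot k A n ∘ₗ face k A n (Fin.last n) := by
  refine PiTensorProduct.ext (MultilinearMap.ext fun a => ?_)
  simp only [LinearMap.compMultilinearMap_apply, LinearMap.comp_apply, face_tprod, rot_tprod]
  congr 1
  funext l
  refine Fin.cases ?_ (fun l => ?_) l
  · rw [finRotate_symm_zero, Fin.contractNth_apply_of_eq _ _ _ _ (by simp),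
      Fin.contractNth_apply_of_eq _ _ _ _ (by simp), Fin.castSucc_zero, finRotate_symm_zero,
      finRotate_symm_succ, ← Fin.succ_last, finRotate_symm_succ, Fin.castSucc_zero,
      finRotate_symm_zero, Fin.succ_last]
  · rw [finRotate_symm_succ, Fin.contractNth_apply_of_gt _ _ _ _ (by simp),
      Fin.contractNth_apply_of_lt _ _ _ _ (by simp), finRotate_symm_succ, ← Fin.succ_castSucc,
      finRotate_symm_succ]

theorem rot_pow_tprod (n m : ℕ) (a : Fin (n + 1) → A) :
    (rot k A n ^ m) (PiTensorProduct.tprod k a) =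
      PiTensorProduct.tprod k (fun i => a (((finRotate (n + 1)).symm ^ m) i)) := by
  induction m generalizing a with
  | zero => simp
  | succ m ih =>
    rw [pow_succ, Module.End.mul_apply, rot_tprod, ih]
    simp only [pow_succ', Equiv.Perm.mul_apply]

theorem finRotate_pow (n : ℕ) : finRotate (n + 1) ^ (n + 1) = 1 := by
  have h : ∀ (m : ℕ) (i : Fin (n + 1)), (finRotate (n + 1) ^ m) i = i + Fin.ofNat (n + 1) m := by
    intro m
    induction m with
    | zero => intro i; ext; simp
    | succ m ih =>
      intro i
      rw [pow_succ', Equiv.Perm.mul_apply, ih, finRotate_apply]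
      ext
      simp [Fin.val_add, add_assoc]
  ext i
  rw [h]
  simp

theorem t_pow_succ (n : ℕ) : t k A n ^ (n + 1) = 1 := by
  have h : rot k A n ^ (n + 1) = 1 := by
    refine PiTensorProduct.ext (MultilinearMap.ext fun a => ?_)
    simp only [LinearMap.compMultilinearMap_apply, rot_pow_tprod]
    have : (finRotate (n + 1)).symm ^ (n + 1) = 1 := by
      rw [← Equiv.Perm.inv_def, inv_pow, finRotate_pow, inv_one]
    simp [this]
  rw [t, smul_pow, h, ← pow_mul, (Nat.even_mul_succ_self n).neg_one_pow, one_smul]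

theorem comp_sum {ι M₁ M₂ M₃ : Type*} [AddCommGroup M₁] [AddCommGroup M₂] [AddCommGroup M₃]
    [Module k M₁] [Module k M₂] [Module k M₃] (s : Finset ι) (g : M₂ →ₗ[k] M₃)
    (f : ι → M₁ →ₗ[k] M₂) : g ∘ₗ (∑ i ∈ s, f i) = ∑ i ∈ s, g ∘ₗ f i :=
  LinearMap.ext fun x => by simp [LinearMap.sum_apply]

theorem sum_comp {ι M₁ M₂ M₃ : Type*} [AddCommGroup M₁] [AddCommGroup M₂] [AddCommGroup M₃]
    [Module k M₁] [Module k M₂] [Module k M₃] (s : Finset ι) (g : ι → M₂ →ₗ[k] M₃)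
    (f : M₁ →ₗ[k] M₂) : (∑ i ∈ s, g i) ∘ₗ f = ∑ i ∈ s, g i ∘ₗ f :=
  LinearMap.ext fun x => by simp [LinearMap.sum_apply]

theorem face_t (n : ℕ) (i : Fin n) :
    ((-1 : k) ^ (i.succ : ℕ) • face k A n i.succ) ∘ₗ t k A (n + 1) =
      t k A n ∘ₗ ((-1 : k) ^ (i : ℕ) • face k A n i.castSucc) := by
  simp only [t, LinearMap.comp_smul, LinearMap.smul_comp, face_rot, smul_smul, ← pow_add,
    Fin.val_succ]
  congr 1
  ring

theorem face_t_t (n : ℕ) :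
    face k A n 0 ∘ₗ t k A (n + 1) ∘ₗ t k A (n + 1) =
      t k A n ∘ₗ ((-1 : k) ^ n • face k A n (Fin.last n)) := by
  simp only [t, LinearMap.comp_smul, LinearMap.smul_comp, face_rot_rot, smul_smul, ← pow_add]
  congr 1
  rw [Even.neg_one_pow ⟨_, rfl⟩, Even.neg_one_pow ⟨_, rfl⟩]

theorem b_eq (n : ℕ) : b k A n = bPrime k A n + face k A n 0 ∘ₗ t k A (n + 1) := by
  simp [b, t, lastFace, LinearMap.comp_smul]

theorem t_bPrime (n : ℕ) :
    t k A n ∘ₗ bPrime k A n = (b k A n - face k A n 0) ∘ₗ t k A (n + 1) := by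
  have h1 : bPrime k A n ∘ₗ t k A (n + 1) = face k A n 0 ∘ₗ t k A (n + 1) +
      ∑ i : Fin n, t k A n ∘ₗ ((-1 : k) ^ (i : ℕ) • face k A n i.castSucc) := by
    rw [bPrime, Fin.sum_univ_succ, LinearMap.add_comp, sum_comp]
    simp only [face_t]
    simp
  have h2 : t k A n ∘ₗ bPrime k A n =
      (∑ i : Fin n, t k A n ∘ₗ ((-1 : k) ^ (i : ℕ) • face k A n i.castSucc)) +
        face k A n 0 ∘ₗ t k A (n + 1) ∘ₗ t k A (n + 1) := by
    rw [face_t_t, bPrime, Fin.sum_univ_castSucc, LinearMap.comp_add, comp_sum]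
    simp
  rw [h2, b_eq, LinearMap.sub_comp, LinearMap.add_comp, h1, LinearMap.comp_assoc]
  abel

theorem sum_split {M : Type*} [AddCommMonoid M] (n : ℕ) (i : Fin (n + 1)) (g : Fin (n + 2) → M) :
    ∑ j, g j = ∑ j : Fin (n + 1),
      ((if i ≤ j then g j.succ else 0) + if j ≤ i then g j.castSucc else 0) := by
  rw [Fin.sum_univ_succAbove _ i.succ]
  have h : ∀ j : Fin (n + 1),
      ((if i ≤ j then g j.succ else 0) + if j ≤ i then g j.castSucc else 0) =
        (if i = j then g i.succ else 0) + g (i.succ.succAbove j) := by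
    intro j
    rcases lt_trichotomy i j with h | rfl | h
    · rw [if_pos h.le, if_neg (not_le.mpr h), if_neg h.ne,
        Fin.succAbove_of_le_castSucc _ _ (by simpa [Fin.le_def] using h), add_comm]
    · simp
    · rw [if_neg (not_le.mpr h), if_pos h.le, if_neg h.ne',
        Fin.succAbove_of_castSucc_lt _ _ (by simpa using h.le)]
  rw [Finset.sum_congr rfl fun j _ => h j, Finset.sum_add_distrib]
  simp

theorem bPrime_bPrime (n : ℕ) : bPrime k A n ∘ₗ bPrime k A (n + 1) = 0 := by
  have h : bPrime k A n ∘ₗ bPrime k A (n + 1) =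
      ∑ i : Fin (n + 1), ∑ j : Fin (n + 2),
        (-1 : k) ^ ((i : ℕ) + j) • (face k A n i ∘ₗ face k A (n + 1) j) := by
    simp only [bPrime, sum_comp, comp_sum, LinearMap.comp_smul,
      LinearMap.smul_comp, smul_smul, pow_add, Finset.smul_sum]
    rw [Finset.sum_comm]
    simp only [mul_comm]
  rw [h, Finset.sum_congr rfl fun i _ => sum_split n i _]
  simp only [Finset.sum_add_distrib]
  rw [Finset.sum_comm (f := fun i j : Fin (n + 1) => if j ≤ i then
    (-1 : k) ^ ((i : ℕ) + j.castSucc) • (face k A n i ∘ₗ face k A (n + 1) j.castSucc) else 0)]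
  simp only [← Finset.sum_add_distrib]
  refine Finset.sum_eq_zero fun i _ => Finset.sum_eq_zero fun j _ => ?_
  split_ifs with hij
  · rw [face_face k A n i j hij, ← add_smul, Fin.val_succ, Fin.val_castSucc, ← add_assoc, pow_succ,
      add_comm (j : ℕ)]
    simp
  · simp

theorem face_zero_bPrime (n : ℕ) :
    face k A n 0 ∘ₗ bPrime k A (n + 1) =
      face k A n 0 ∘ₗ face k A (n + 1) 0 - bPrime k A n ∘ₗ face k A (n + 1) 0 := by
  have h : ∀ j : Fin (n + 1), face k A n 0 ∘ₗ face k A (n + 1) j.succ =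
      face k A n j ∘ₗ face k A (n + 1) 0 := fun j => face_face k A n 0 j (Fin.zero_le j)
  rw [bPrime, Fin.sum_univ_succ, LinearMap.comp_add, comp_sum]
  simp only [LinearMap.comp_smul, h, bPrime, sum_comp, LinearMap.smul_comp, Fin.val_succ,
    pow_succ]
  simp [sub_eq_add_neg, ← Finset.sum_neg_distrib]
  exact Finset.sum_congr rfl fun j _ => LinearMap.ext fun x => by
    rw [LinearMap.neg_apply, LinearMap.smul_apply, LinearMap.smul_apply, neg_smul]

theorem b_b (n : ℕ) : b k A n ∘ₗ b k A (n + 1) = 0 := by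
  refine LinearMap.ext fun x => ?_
  have hb := fun m y => DFunLike.congr_fun (b_eq k A m) y
  have hbb := fun y => DFunLike.congr_fun (bPrime_bPrime k A n) y
  have ht := fun m y => DFunLike.congr_fun (t_bPrime k A m) y
  have hf := fun y => DFunLike.congr_fun (face_zero_bPrime k A n) y
  have h1 := fun y => DFunLike.congr_fun (face_t k A (n + 1) 0) y
  have h2 := fun y => DFunLike.congr_fun (face_face k A n 0 0 le_rfl) y
  simp only [LinearMap.comp_apply, LinearMap.add_apply, LinearMap.sub_apply, LinearMap.zero_apply,
    LinearMap.smul_apply] at hb hbb ht hf h1 h2 ⊢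
  set y := t k A (n + 2) x with hy
  have h3 : t k A (n + 1) (face k A (n + 1) 0 y) = - face k A (n + 1) 1 (t k A (n + 2) y) := by
    have := h1 y
    simpa using this.symm
  have h4 : t k A (n + 1) (bPrime k A (n + 1) x) =
      bPrime k A (n + 1) y + face k A (n + 1) 0 (t k A (n + 2) y) - face k A (n + 1) 0 y := by
    rw [ht, hb, ← hy]
  have h5 := h2 (t k A (n + 2) y)
  rw [Fin.succ_zero_eq_one, Fin.castSucc_zero] at h5
  rw [hb n, hb (n + 1), ← hy, map_add, map_add, hbb, map_add, h4, h3, map_sub, map_add, map_neg,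
    h5, hf y]
  abel

theorem b_one_sub_t (n : ℕ) :
    b k A n ∘ₗ (1 - t k A (n + 1)) = (1 - t k A n) ∘ₗ bPrime k A n := by
  rw [LinearMap.comp_sub, LinearMap.sub_comp, t_bPrime, LinearMap.sub_comp]
  have h1 : (1 : (⨂[k]^(n + 1) A) →ₗ[k] _) ∘ₗ bPrime k A n = bPrime k A n := rfl
  have h2 : b k A n ∘ₗ (1 : (⨂[k]^(n + 2) A) →ₗ[k] _) = b k A n := rfl
  rw [h1, h2, b_eq]
  abel

theorem t_N (n : ℕ) : t k A n * N k A n = N k A n := by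
  have h := Finset.sum_range_succ (fun i => t k A n ^ i) (n + 1)
  rw [Finset.sum_range_succ', t_pow_succ, pow_zero] at h
  rw [N, Finset.mul_sum]
  simpa only [pow_succ'] using add_right_cancel h

theorem N_t (n : ℕ) : N k A n * t k A n = N k A n := by
  refine Eq.trans ?_ (t_N k A n)
  rw [N, Finset.sum_mul, Finset.mul_sum]
  exact Finset.sum_congr rfl fun i _ => (pow_succ _ _).symm.trans (pow_succ' _ _)

theorem t_pow_N (n m : ℕ) : t k A n ^ m * N k A n = N k A n := by
  induction m with
  | zero => simp
  | succ m ih => rw [pow_succ, mul_assoc, t_N, ih]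

theorem N_t_pow (n m : ℕ) : N k A n * t k A n ^ m = N k A n := by
  induction m with
  | zero => simp
  | succ m ih => rw [pow_succ', ← mul_assoc, N_t, ih]

theorem face_t_pow (n : ℕ) (i : Fin (n + 1)) (x : ⨂[k]^(n + 2) A) :
    (-1 : k) ^ (i : ℕ) • face k A n i ((t k A (n + 1) ^ (i : ℕ)) x) =
      (t k A n ^ (i : ℕ)) (face k A n 0 x) := by
  induction i using Fin.induction generalizing x with
  | zero => simp
  | succ i ih =>
    have h := DFunLike.congr_fun (face_t k A n i) ((t k A (n + 1) ^ (i : ℕ)) x)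
    simp only [LinearMap.comp_apply, LinearMap.smul_apply] at h
    rw [Fin.val_succ] at h ⊢
    rw [pow_succ' (t k A (n + 1)), pow_succ' (t k A n), Module.End.mul_apply,
      Module.End.mul_apply, h]
    exact congrArg (t k A n) (ih x)

theorem bPrime_N (n : ℕ) :
    bPrime k A n ∘ₗ N k A (n + 1) = N k A n ∘ₗ b k A n := by
  refine LinearMap.ext fun x => ?_
  have hl : bPrime k A n (N k A (n + 1) x) = N k A n (face k A n 0 (N k A (n + 1) x)) := by
    have h : ∀ i : Fin (n + 1), (-1 : k) ^ (i : ℕ) • face k A n i (N k A (n + 1) x) =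
        (t k A n ^ (i : ℕ)) (face k A n 0 (N k A (n + 1) x)) := by
      intro i
      rw [← face_t_pow, ← Module.End.mul_apply, t_pow_N]
    rw [bPrime, LinearMap.sum_apply]
    simp only [LinearMap.smul_apply, h]
    generalize face k A n 0 (N k A (n + 1) x) = z
    rw [N, LinearMap.sum_apply, Finset.sum_range]
  have h : ∀ i : Fin (n + 1), N k A n ((-1 : k) ^ (i : ℕ) • face k A n i x) =
      N k A n (face k A n 0 ((t k A (n + 1) ^ (n + 2 - i)) x)) := by
    intro i
    have h1 := face_t_pow k A n i ((t k A (n + 1) ^ (n + 2 - i)) x)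
    rw [← Module.End.mul_apply, ← pow_add, Nat.add_sub_cancel' (by omega), t_pow_succ,
      Module.End.one_apply] at h1
    rw [h1, ← Module.End.mul_apply, N_t_pow]
  have hr : N k A n (b k A n x) = N k A n (face k A n 0 (N k A (n + 1) x)) := by
    rw [b_eq, LinearMap.add_apply, map_add, bPrime, LinearMap.sum_apply, map_sum]
    simp only [LinearMap.smul_apply, h, LinearMap.comp_apply]
    rw [← map_sum, ← map_sum, ← map_add, ← map_add]
    congr 2
    have h2 : N k A (n + 1) = ∑ i ∈ Finset.range (n + 2), t k A (n + 1) ^ (n + 2 - i) := by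
      rw [← t_N, N, Finset.mul_sum, ← Finset.sum_range_reflect]
      refine Finset.sum_congr rfl fun i hi => ?_
      rw [Finset.mem_range] at hi
      rw [← pow_succ']
      congr 1
      omega
    rw [h2, Finset.sum_range_succ, Finset.sum_range, LinearMap.add_apply, LinearMap.sum_apply]
    congr 2
    rw [show n + 2 - (n + 1) = 1 by omega, pow_one]
  rw [LinearMap.comp_apply, LinearMap.comp_apply, hl, hr]

/-- The total differential squares to zero. -/
theorem D_D (n : ℤ) (c : Tot k A) : D k A n (D k A (n + 1) c) = 0 := by
  funext q
  have e1 : n + 1 - (((q + 1 : ℕ) : ℤ) + 1) = n - (q + 1) := by push_cast; ring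
  have e2 : n + 1 - ((q + 1 : ℕ) : ℤ) = n - q := by push_cast; ring
  have e3 : n + 1 - ((q : ℤ) + 1) = n - q := by ring
  rw [D_apply, D_apply, D_apply, e1, e2, e3, map_add, map_add]
  have g1 := DFunLike.congr_fun (b_b k A q) (c (q + 2))
  have g2 := DFunLike.congr_fun (bPrime_bPrime k A q) (c (q + 2))
  have g3 := DFunLike.congr_fun (b_one_sub_t k A q) (c (q + 1))
  have g4 := DFunLike.congr_fun (bPrime_N k A q) (c (q + 1))
  have g5 := DFunLike.congr_fun (N_t k A q) (c q)
  have g6 := DFunLike.congr_fun (t_N k A q) (c q)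
  simp only [LinearMap.comp_apply, Module.End.mul_apply, LinearMap.sub_apply,
    LinearMap.zero_apply, Module.End.one_apply] at g1 g2 g3 g4 g5 g6
  by_cases hp : Even (n - (q : ℤ))
  · have hm : ¬ Even (n - ((q : ℤ) + 1)) := by
      rw [← sub_sub, Int.even_sub_one]; simpa using hp
    have hn : ¬ Even (n + 1 - (q : ℤ)) := by
      rw [add_sub_right_comm, Int.even_add_one]; simpa using hp
    simp only [vert, horiz, if_pos hp, if_neg hm, if_neg hn, LinearMap.neg_apply,
      LinearMap.sub_apply, Module.End.one_apply, map_neg, map_sub, neg_neg, Pi.zero_apply]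
    rw [g2, g4, g5]
    abel
  · have hm : Even (n - ((q : ℤ) + 1)) := by
      rw [← sub_sub, Int.even_sub_one]; simpa using hp
    have hn : Even (n + 1 - (q : ℤ)) := by
      rw [add_sub_right_comm, Int.even_add_one]; simpa using hp
    simp only [vert, horiz, if_neg hp, if_pos hm, if_pos hn, LinearMap.neg_apply,
      LinearMap.sub_apply, Module.End.one_apply, map_neg, Pi.zero_apply]
    rw [g1, g3, g6]
    abel

end Bicomplex

/-! ### The algebra `k[x₁, …, x_d] / 𝔪²` and the weight decomposition -/

section Weight

/-- `k[x₁, …, x_d] / 𝔪²` with `𝔪 = (x₁, …, x_d)`. -/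
abbrev SqZero (k : Type*) [CommRing k] (d : ℕ) : Type _ :=
  MvPolynomial (Fin d) k ⧸ MvPolynomial.idealOfVars (Fin d) k ^ 2

variable (k : Type*) [CommRing k] (d : ℕ)

/-- The class of the monomial `x₁^{e₁} ⋯ x_d^{e_d}`. -/
def mono (e : Fin d →₀ ℕ) : SqZero k d :=
  Ideal.Quotient.mk _ (MvPolynomial.monomial e 1)

theorem mono_mul (e f : Fin d →₀ ℕ) : mono k d e * mono k d f = mono k d (e + f) := by
  simp [mono, ← map_mul, MvPolynomial.monomial_mul]

/-- The submodule of `A^{⊗ (n+1)}` spanned by the tensor monomials of weight `w`, i.e. by the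
`m₀ ⊗ ⋯ ⊗ mₙ` where the `mᵢ` are monomials with `w` factors `xⱼ` in total. -/
def weight (w n : ℕ) : Submodule k (⨂[k]^(n + 1) (SqZero k d)) :=
  Submodule.span k
    {x | ∃ e : Fin (n + 1) → (Fin d →₀ ℕ), ∑ i, (e i).degree = w ∧
      x = PiTensorProduct.tprod k (fun i => mono k d (e i))}

/-- The weight `w` part of the total object: the product of the weight `w` parts of the entries. -/
def totWeight (w : ℕ) : Submodule k (Tot k (SqZero k d)) :=
  Submodule.pi Set.univ fun q => weight k d w q

theorem sum_contractNth (n : ℕ) (i : Fin (n + 1)) (g : Fin (n + 2) → ℕ) :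
    ∑ l, i.castSucc.contractNth (· + ·) g l = ∑ l, g l := by
  have key : ∀ l : Fin (n + 1), i.castSucc.contractNth (· + ·) g l =
      g (i.succ.succAbove l) + if l = i then g i.succ else 0 := by
    intro l
    rcases lt_trichotomy l i with h | rfl | h
    · have h1 : (l : ℕ) < i := h
      rw [Fin.contractNth_apply_of_lt _ _ _ _ (by simpa using h1), if_neg h.ne, add_zero,
        Fin.succAbove_of_castSucc_lt]
      rw [Fin.lt_def]; simp; omega
    · rw [Fin.contractNth_apply_of_eq _ _ _ _ (by simp), if_pos rfl,
        Fin.succAbove_of_castSucc_lt]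
      rw [Fin.lt_def]; simp
    · have h1 : (i : ℕ) < l := h
      rw [Fin.contractNth_apply_of_gt _ _ _ _ (by simpa using h1), if_neg h.ne', add_zero,
        Fin.succAbove_of_le_castSucc]
      rw [Fin.le_def]; simp; omega
  rw [Fin.sum_univ_succAbove _ i.succ, Finset.sum_congr rfl fun l _ => key l,
    Finset.sum_add_distrib]
  simp [add_comm]

theorem face_mem_weight (w n : ℕ) (i : Fin (n + 1)) {x} (hx : x ∈ weight k d w (n + 1)) :
    face k (SqZero k d) n i x ∈ weight k d w n := by
  induction hx using Submodule.span_induction with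
  | mem x h =>
    obtain ⟨e, he, rfl⟩ := h
    refine Submodule.subset_span ⟨i.castSucc.contractNth (· + ·) e, ?_, ?_⟩
    · rw [← he, ← sum_contractNth n i]
      refine Finset.sum_congr rfl fun l _ => ?_
      simp only [Fin.contractNth]
      split_ifs <;> simp
    · rw [face_tprod]
      congr 1
      funext l
      simp only [Fin.contractNth]
      split_ifs <;> simp [mono_mul]
  | zero => simp
  | add x y _ _ hx hy => rw [map_add]; exact add_mem hx hy
  | smul c x _ hx => rw [map_smul]; exact Submodule.smul_mem _ c hx

theorem rot_mem_weight (w n : ℕ) {x} (hx : x ∈ weight k d w n) :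
    rot k (SqZero k d) n x ∈ weight k d w n := by
  induction hx using Submodule.span_induction with
  | mem x h =>
    obtain ⟨e, he, rfl⟩ := h
    refine Submodule.subset_span ⟨fun i => e ((finRotate (n + 1)).symm i), ?_, ?_⟩
    · rw [← he, Equiv.sum_comp (finRotate (n + 1)).symm fun i => (e i).degree]
    · rw [rot_tprod]
  | zero => simp
  | add x y _ _ hx hy => rw [map_add]; exact add_mem hx hy
  | smul c x _ hx => rw [map_smul]; exact Submodule.smul_mem _ c hx

theorem t_mem_weight (w n : ℕ) {x} (hx : x ∈ weight k d w n) :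
    t k (SqZero k d) n x ∈ weight k d w n :=
  Submodule.smul_mem _ _ (rot_mem_weight k d w n hx)

theorem N_mem_weight (w n : ℕ) {x} (hx : x ∈ weight k d w n) :
    N k (SqZero k d) n x ∈ weight k d w n := by
  have h : ∀ i : ℕ, (t k (SqZero k d) n ^ i) x ∈ weight k d w n := by
    intro i
    induction i with
    | zero => exact hx
    | succ i ih =>
      have h1 : (t k (SqZero k d) n ^ (i + 1)) x =
          t k (SqZero k d) n ((t k (SqZero k d) n ^ i) x) :=
        DFunLike.congr_fun (pow_succ' _ i) x
      rw [h1]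
      exact t_mem_weight k d w n ih
  rw [N, LinearMap.sum_apply]
  exact Submodule.sum_mem _ fun i _ => h i

theorem bPrime_mem_weight (w n : ℕ) {x} (hx : x ∈ weight k d w (n + 1)) :
    bPrime k (SqZero k d) n x ∈ weight k d w n := by
  rw [bPrime, LinearMap.sum_apply]
  exact Submodule.sum_mem _ fun i _ => Submodule.smul_mem _ _ (face_mem_weight k d w n i hx)

theorem b_mem_weight (w n : ℕ) {x} (hx : x ∈ weight k d w (n + 1)) :
    b k (SqZero k d) n x ∈ weight k d w n :=
  add_mem (bPrime_mem_weight k d w n hx) (Submodule.smul_mem _ _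
    (face_mem_weight k d w n 0 (rot_mem_weight k d w (n + 1) hx)))

/-- The differentials preserve weight. -/
theorem D_mem_totWeight (w : ℕ) (n : ℤ) (c : Tot k (SqZero k d)) (hc : c ∈ totWeight k d w) :
    D k (SqZero k d) n c ∈ totWeight k d w := by
  intro q _
  have h1 : c (q + 1) ∈ weight k d w (q + 1) := hc (q + 1) trivial
  have h0 : c q ∈ weight k d w q := hc q trivial
  rw [D_apply]
  refine add_mem ?_ ?_
  · unfold vert
    split_ifs
    · exact b_mem_weight k d w q h1
    · exact neg_mem (bPrime_mem_weight k d w q h1)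
  · unfold horiz
    split_ifs
    · exact N_mem_weight k d w q h0
    · exact sub_mem h0 (t_mem_weight k d w q h0)

/-- The cycles of weight `w` in degree `n`. -/
def cycles (w : ℕ) (n : ℤ) : Submodule k (Tot k (SqZero k d)) :=
  totWeight k d w ⊓ LinearMap.ker (D k (SqZero k d) n)

/-- The boundaries of weight `w` in degree `n`: the image of the chains of weight `w` in degree
`n + 1`. -/
def boundaries (w : ℕ) (n : ℤ) : Submodule k (Tot k (SqZero k d)) :=
  (totWeight k d w).map (D k (SqZero k d) (n + 1))

theorem boundaries_le_cycles (w : ℕ) (n : ℤ) : boundaries k d w n ≤ cycles k d w n := by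
  rintro _ ⟨c, hc, rfl⟩
  exact ⟨D_mem_totWeight k d w _ c hc, D_D k (SqZero k d) n c⟩

/-- The weight `w` part `HP_n^{(w)}` of the periodic cyclic homology of `k[x₁, …, x_d] / 𝔪²`: the
homology in degree `n` of the subcomplex of weight `w` of the total complex, i.e. cycles modulo
boundaries. -/
abbrev HPWeight (w : ℕ) (n : ℤ) : Type _ :=
  cycles k d w n ⧸ (boundaries k d w n).submoduleOf (cycles k d w n)

end Weight

/-! ### Cycle families of words -/

section Words

/-- Words of length `m` in `x₁, …, x_d`. -/
abbrev Word (m d : ℕ) : Type := Fin m → Fin d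

/-- The rotation `x_{j₁} ⋯ x_{j_m} ↦ x_{j_m} x_{j₁} ⋯ x_{j_{m-1}}`. -/
def Word.rotate {m d : ℕ} (u : Word m d) : Word m d :=
  fun i => u ((finRotate m).symm i)

/-- The cycle length of a word: the least `r > 0` such that `r` rotations fix the word. -/
def Word.cycleLength {m d : ℕ} (u : Word m d) : ℕ :=
  sInf {r | 0 < r ∧ Word.rotate^[r] u = u}

/-- The cycle family of a word: the set of all its rotations. -/
def Word.cycleFamily {m d : ℕ} (u : Word m d) : Set (Word m d) :=
  {v | ∃ r : ℕ, v = Word.rotate^[r] u}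

/-- The set of all cycle families of words of length `m` and cycle length `m` in `x₁, …, x_d`. -/
def omega (m d : ℕ) : Set (Set (Word m d)) :=
  {S | ∃ u : Word m d, u.cycleLength = m ∧ S = u.cycleFamily}

end Words

end CyclicHomology

end

/-! In `A` every monomial of degree at least 2 vanishes, so a nonzero tensor monomial of weight `w`
has at least `w` factors. For `w = w' + 1` the weight `w` bicomplex thus starts in row `w'`, whose
entries are free on the words of length `w`. There `1 - t` and `N` form the Tate complex of a cyclic
group of order `w` rotating words with the sign `(-1) ^ w'`.

The rows above form an acyclic quotient complex (`exists_D_eq`), so this bottom row carries all the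
homology. Let `I` be the augmentation ideal, `C` the Hochschild complex and `B` the two-sided bar
complex with trivial coefficients (`barBoth`). As `I² = 0`, `C` has the subcomplex `I ⊗ B` with
quotient `B`, and `barHomotopy` contracts `B` onto the tensor powers of `I`. Hence in weight `w` the
homology of `C` can live only in rows `w'` and `w' + 1`, while the bar columns are contractible.
Once row `w'` is cut off, each column has homology only in row `w' + 1`, namely the cokernel of `b`
or `b'`. There `1 - t` induces an isomorphism from the cokernel of `b'` to that of `b`
(`exists_b_add_eq`, `exists_bPrime_eq`), so `N` induces zero and the row of cokernels is exact.

Words of length `w` split into rotation cycles. By Shapiro's lemma, a cycle of length `m`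
contributes the Tate cohomology of its stabilizer, of order `w / m`, acting on `ℤ` through the sign
`((-1) ^ w') ^ m`. Sign `1` gives `ℤ/(w/m)` in `ker (1 - t) / im N` and nothing in `ker N / im (1 -
t)`; sign `-1` gives nothing in the former and `ℤ/2` in the latter. The sign is `1` exactly if `m ≡
w` modulo 2. Repeating words identifies the cycles of length `m` with `omega m d`; counting words
and Möbius inversion give the size of `omega m d`.

In weight zero each entry is `ℤ`, spanned by `1 ⊗ ⋯ ⊗ 1`. The differential vanishes in odd degrees
and is a recursion with invertible leading coefficient in even degrees. -/

noncomputable section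

namespace CyclicHomology

/-! ### Building tensors from the left -/

section Cons

variable (k : Type*) {A : Type*} [CommRing k] [Ring A] [Algebra k A]

/-- `a ⊗ (a₁ ⊗ ⋯ ⊗ aₙ) ↦ a ⊗ a₁ ⊗ ⋯ ⊗ aₙ`. -/
def consT (n : ℕ) : A →ₗ[k] (⨂[k]^n A) →ₗ[k] (⨂[k]^(n + 1) A) :=
  PiTensorProduct.lift.toLinearMap ∘ₗ
    (PiTensorProduct.tprod k : MultilinearMap k (fun _ : Fin (n + 1) => A) _).curryLeft

@[simp]
theorem consT_tprod (n : ℕ) (a : A) (x : Fin n → A) :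
    consT k n a (PiTensorProduct.tprod k x) =
      PiTensorProduct.tprod k (Fin.cons a x : Fin (n + 1) → A) :=
  PiTensorProduct.lift.tprod _

/-- The linear map on `A^{⊗ (n+1)}` determined by a bilinear map on `A × A^{⊗ n}`. -/
def consLift {n : ℕ} {M : Type*} [AddCommGroup M] [Module k M]
    (g : A →ₗ[k] (⨂[k]^n A) →ₗ[k] M) : (⨂[k]^(n + 1) A) →ₗ[k] M :=
  PiTensorProduct.lift (LinearMap.uncurryLeft (M := fun _ : Fin (n + 1) => A)
    (PiTensorProduct.lift.symm.toLinearMap ∘ₗ g))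

theorem tprod_ext {n : ℕ} {M : Type*} [AddCommGroup M] [Module k M]
    {f g : (⨂[k]^n A) →ₗ[k] M}
    (h : ∀ x : Fin n → A, f (PiTensorProduct.tprod k x) = g (PiTensorProduct.tprod k x)) :
    f = g :=
  PiTensorProduct.ext (MultilinearMap.ext h)

@[simp]
theorem consLift_consT {n : ℕ} {M : Type*} [AddCommGroup M] [Module k M]
    (g : A →ₗ[k] (⨂[k]^n A) →ₗ[k] M) (a : A) (x : ⨂[k]^n A) :
    consLift k g (consT k n a x) = g a x := by
  refine DFunLike.congr_fun (f := consLift k g ∘ₗ consT k n a) (tprod_ext k fun x => ?_) x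
  rw [LinearMap.comp_apply, consT_tprod, consLift, PiTensorProduct.lift.tprod]
  simp [PiTensorProduct.lift_symm]

theorem cons_ext {n : ℕ} {M : Type*} [AddCommGroup M] [Module k M]
    {f g : (⨂[k]^(n + 1) A) →ₗ[k] M} (h : ∀ a x, f (consT k n a x) = g (consT k n a x)) :
    f = g := by
  refine tprod_ext k fun x => ?_
  rw [← Fin.cons_self_tail x, ← consT_tprod, h]

theorem face_zero_consT (n : ℕ) (a c : A) (u : ⨂[k]^n A) :
    face k A n 0 (consT k (n + 1) a (consT k n c u)) = consT k n (a * c) u := by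
  refine DFunLike.congr_fun (f := face k A n 0 ∘ₗ consT k (n + 1) a ∘ₗ consT k n c)
    (tprod_ext k fun x => ?_) u
  simp only [LinearMap.comp_apply, consT_tprod, face_tprod]
  congr 1
  funext l
  refine Fin.cases ?_ (fun l => ?_) l
  · rw [Fin.contractNth_apply_of_eq _ _ _ _ (by simp)]
    simp
  · rw [Fin.contractNth_apply_of_gt _ _ _ _ (by simp)]
    simp

theorem face_succ_consT (n : ℕ) (i : Fin (n + 1)) (a : A) (u : ⨂[k]^(n + 2) A) :
    face k A (n + 1) i.succ (consT k (n + 2) a u) = consT k (n + 1) a (face k A n i u) := by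
  refine DFunLike.congr_fun (f := face k A (n + 1) i.succ ∘ₗ consT k (n + 2) a)
    (g := consT k (n + 1) a ∘ₗ face k A n i) (tprod_ext k fun x => ?_) u
  simp only [LinearMap.comp_apply, consT_tprod, face_tprod]
  congr 1
  funext l
  refine Fin.cases ?_ (fun l => ?_) l
  · rw [Fin.contractNth_apply_of_lt _ _ _ _ (by simp)]
    simp
  · simp only [Fin.contractNth, Fin.val_castSucc, Fin.val_succ,
      Nat.add_lt_add_iff_right, Nat.add_right_cancel_iff, Fin.cons_succ]
    simp only [← Fin.succ_castSucc, Fin.cons_succ]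

theorem bPrime_zero : bPrime k A 0 = face k A 0 0 := by
  simp [bPrime]

theorem bPrime_succ_consT (n : ℕ) (a : A) (u : ⨂[k]^(n + 2) A) :
    bPrime k A (n + 1) (consT k (n + 2) a u) =
      face k A (n + 1) 0 (consT k (n + 2) a u) - consT k (n + 1) a (bPrime k A n u) := by
  rw [bPrime, Fin.sum_univ_succ, LinearMap.add_apply, LinearMap.sum_apply, bPrime,
    LinearMap.sum_apply, map_sum, sub_eq_add_neg, ← Finset.sum_neg_distrib]
  simp only [LinearMap.smul_apply, face_succ_consT, map_smul, Fin.val_succ, pow_succ]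
  simp

theorem face_zero_consT_one (n : ℕ) (u : ⨂[k]^(n + 1) A) :
    face k A n 0 (consT k (n + 1) 1 u) = u := by
  refine DFunLike.congr_fun (f := face k A n 0 ∘ₗ consT k (n + 1) 1) (g := LinearMap.id)
    (cons_ext k fun a x => ?_) u
  simp [face_zero_consT]

theorem lastFace_consT (n : ℕ) (a : A) (x : Fin (n + 1) → A) :
    lastFace k A n (consT k (n + 1) a (PiTensorProduct.tprod k x)) =
      consT k n (x (Fin.last n) * a) (PiTensorProduct.tprod k (Fin.init x)) := by
  rw [lastFace, LinearMap.comp_apply, consT_tprod, rot_tprod]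
  have : (fun i => (Fin.cons a x : Fin (n + 2) → A) ((finRotate (n + 2)).symm i)) =
      Fin.cons (x (Fin.last n)) (Fin.cons a (Fin.init x) : Fin (n + 1) → A) := by
    funext l
    refine Fin.cases ?_ (fun l => ?_) l
    · rw [finRotate_symm_zero, ← Fin.succ_last, Fin.cons_succ, Fin.cons_zero]
    · rw [finRotate_symm_succ, Fin.cons_succ]
      refine Fin.cases ?_ (fun l => ?_) l
      · simp
      · rw [← Fin.succ_castSucc, Fin.cons_succ, Fin.cons_succ, Fin.init]
  rw [this, ← consT_tprod, ← consT_tprod, face_zero_consT]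

theorem rot_consT_tprod (n : ℕ) (x : Fin (n + 1) → A) :
    rot k A n (PiTensorProduct.tprod k x) =
      consT k n (x (Fin.last n)) (PiTensorProduct.tprod k (Fin.init x)) := by
  rw [rot_tprod, consT_tprod]
  congr 1
  funext l
  refine Fin.cases ?_ (fun l => ?_) l
  · rw [finRotate_symm_zero, Fin.cons_zero]
  · rw [finRotate_symm_succ, Fin.cons_succ, Fin.init]

theorem lastFace_consT_one (n : ℕ) (u : ⨂[k]^(n + 1) A) :
    lastFace k A n (consT k (n + 1) 1 u) = rot k A n u := by
  refine DFunLike.congr_fun (f := lastFace k A n ∘ₗ consT k (n + 1) 1) (tprod_ext k fun x => ?_) u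
  rw [LinearMap.comp_apply, lastFace_consT, rot_consT_tprod, mul_one]

/-- `b' s + s b' = 1` for the extra degeneracy `s(x) = 1 ⊗ x`. -/
theorem bPrime_consT_one (n : ℕ) (u : ⨂[k]^(n + 2) A) :
    bPrime k A (n + 1) (consT k (n + 2) 1 u) = u - consT k (n + 1) 1 (bPrime k A n u) := by
  rw [bPrime_succ_consT, face_zero_consT_one]

theorem bPrime_zero_consT_one (u : ⨂[k]^1 A) :
    bPrime k A 0 (consT k 1 1 u) = u := by
  rw [bPrime_zero, face_zero_consT_one]

theorem smul_rot (n : ℕ) (u : ⨂[k]^(n + 1) A) :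
    (-1 : k) ^ (n + 1) • rot k A n u = - t k A n u := by
  rw [t, LinearMap.smul_apply, pow_succ, mul_neg_one, neg_smul]

/-- `b s + s b' = 1 - t`. -/
theorem b_consT_one (n : ℕ) (u : ⨂[k]^(n + 2) A) :
    b k A (n + 1) (consT k (n + 2) 1 u) =
      u - t k A (n + 1) u - consT k (n + 1) 1 (bPrime k A n u) := by
  rw [b, LinearMap.add_apply, bPrime_consT_one, LinearMap.smul_apply, lastFace_consT_one, smul_rot]
  abel

theorem b_zero_consT_one (u : ⨂[k]^1 A) :
    b k A 0 (consT k 1 1 u) = u - t k A 0 u := by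
  rw [b, LinearMap.add_apply, bPrime_zero_consT_one, LinearMap.smul_apply, lastFace_consT_one,
    smul_rot]
  abel

end Cons

/-! ### The bar complex of an augmented algebra whose augmentation ideal has square zero -/

section Augmented

variable {k A : Type*} [CommRing k] [Ring A] [Algebra k A] (ε : A →ₐ[k] k)

/-- The projection `a ↦ a - ε(a)` onto the augmentation ideal. -/
def augProj : A →ₗ[k] A :=
  LinearMap.id - Algebra.linearMap k A ∘ₗ ε.toLinearMap

theorem augProj_apply (a : A) : augProj ε a = a - algebraMap k A (ε a) := rfl

@[simp]
theorem augProj_one : augProj ε 1 = 0 := by simp [augProj_apply]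

theorem augProj_of_aug_eq_zero {a : A} (h : ε a = 0) : augProj ε a = a := by
  simp [augProj_apply, h]

@[simp]
theorem aug_augProj (a : A) : ε (augProj ε a) = 0 := by simp [augProj_apply]

theorem eq_smul_one_add_augProj (a : A) : a = ε a • (1 : A) + augProj ε a := by
  rw [augProj_apply, Algebra.smul_def, mul_one]; abel

/-- `A` is spanned by `1` and the augmentation ideal. The identities below are checked on these two
kinds of first factor, where faces either cancel a `1` or multiply inside the ideal and vanish. -/
theorem aug_ext {n : ℕ} {M : Type*} [AddCommGroup M] [Module k M]
    {f g : (⨂[k]^(n + 1) A) →ₗ[k] M} (h1 : ∀ x, f (consT k n 1 x) = g (consT k n 1 x))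
    (h2 : ∀ a x, ε a = 0 → f (consT k n a x) = g (consT k n a x)) : f = g := by
  refine cons_ext k fun a x => ?_
  rw [eq_smul_one_add_augProj ε a]
  simp only [map_add, map_smul, LinearMap.add_apply, LinearMap.smul_apply, h1,
    h2 _ _ (aug_augProj ε a)]

/-- `a₁ ⊗ ⋯ ⊗ aₙ₊₁ ↦ ε(a₁) a₂ ⊗ ⋯ ⊗ aₙ₊₁`. -/
def augFirst (n : ℕ) : (⨂[k]^(n + 1) A) →ₗ[k] (⨂[k]^n A) :=
  consLift k (LinearMap.lsmul k (⨂[k]^n A) ∘ₗ ε.toLinearMap)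

@[simp]
theorem augFirst_consT (n : ℕ) (a : A) (u : ⨂[k]^n A) :
    augFirst ε n (consT k n a u) = ε a • u := by
  simp [augFirst]

/-- `a₁ ⊗ ⋯ ⊗ aₙ₊₁ ↦ ε(aₙ₊₁) a₁ ⊗ ⋯ ⊗ aₙ`. -/
def augLast : (n : ℕ) → (⨂[k]^(n + 1) A) →ₗ[k] (⨂[k]^n A)
  | 0 => augFirst ε 0
  | n + 1 => consLift k ((consT k n).compl₂ (augLast n))

@[simp]
theorem augLast_zero_consT (a : A) (u : ⨂[k]^0 A) :
    augLast ε 0 (consT k 0 a u) = ε a • u :=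
  augFirst_consT ε 0 a u

@[simp]
theorem augLast_succ_consT (n : ℕ) (a : A) (u : ⨂[k]^(n + 1) A) :
    augLast ε (n + 1) (consT k (n + 1) a u) = consT k n a (augLast ε n u) := by
  simp [augLast]

theorem augLast_tprod (n : ℕ) (x : Fin (n + 1) → A) :
    augLast ε n (PiTensorProduct.tprod k x) =
      ε (x (Fin.last n)) • PiTensorProduct.tprod k (Fin.init x) := by
  induction n with
  | zero =>
    rw [← Fin.cons_self_tail x, ← consT_tprod, augLast_zero_consT]
    congr 2
    exact Subsingleton.elim _ _
  | succ n ih =>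
    conv_lhs => rw [← Fin.cons_self_tail x, ← consT_tprod, augLast_succ_consT, ih]
    rw [map_smul, consT_tprod]
    congr 2
    funext l
    refine Fin.cases ?_ (fun l => ?_) l
    · rfl
    · rfl

/-- The bar differential extended by the augmentation of the last factor. -/
def barRight : (n : ℕ) → (⨂[k]^(n + 1) A) →ₗ[k] (⨂[k]^n A)
  | 0 => augLast ε 0
  | n + 1 => bPrime k A n + (-1 : k) ^ (n + 1) • augLast ε (n + 1)

/-- The differential of the two-sided bar complex with trivial coefficients. -/
def barBoth (n : ℕ) : (⨂[k]^(n + 1) A) →ₗ[k] (⨂[k]^n A) :=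
  augFirst ε n - barRight ε n

/-- The contracting homotopy of the two-sided bar complex away from tensors over the augmentation
ideal: it doubles the first factor `1`. -/
def barHomotopy : (n : ℕ) → (⨂[k]^n A) →ₗ[k] (⨂[k]^(n + 1) A)
  | 0 => 0
  | n + 1 => consLift k
      ((LinearMap.lsmul k (⨂[k]^n A) ∘ₗ ε.toLinearMap).compr₂
          (consT k (n + 1) 1 ∘ₗ consT k n 1) -
        (consT k (n + 1) ∘ₗ augProj ε).compl₂ (barHomotopy n))

/-- The projection onto the tensors over the augmentation ideal. -/
def tensorProj : (n : ℕ) → (⨂[k]^n A) →ₗ[k] (⨂[k]^n A)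
  | 0 => LinearMap.id
  | n + 1 => consLift k ((consT k n ∘ₗ augProj ε).compl₂ (tensorProj n))

/-- The homotopy `a ⊗ u ↦ (a - ε(a)) ⊗ h(u)` of the Hochschild complex. -/
def hochHomotopy (n : ℕ) : (⨂[k]^(n + 1) A) →ₗ[k] (⨂[k]^(n + 2) A) :=
  consLift k ((consT k (n + 1) ∘ₗ augProj ε).compl₂ (barHomotopy ε n))

@[simp]
theorem hochHomotopy_consT (n : ℕ) (a : A) (u : ⨂[k]^n A) :
    hochHomotopy ε n (consT k n a u) = consT k (n + 1) (augProj ε a) (barHomotopy ε n u) := by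
  simp [hochHomotopy]

@[simp]
theorem tensorProj_consT (n : ℕ) (a : A) (u : ⨂[k]^n A) :
    tensorProj ε (n + 1) (consT k n a u) = consT k n (augProj ε a) (tensorProj ε n u) := by
  simp [tensorProj]

theorem barHomotopy_consT (n : ℕ) (a : A) (u : ⨂[k]^n A) :
    barHomotopy ε (n + 1) (consT k n a u) =
      ε a • consT k (n + 1) 1 (consT k n 1 u) -
        consT k (n + 1) (augProj ε a) (barHomotopy ε n u) := by
  simp [barHomotopy]

@[simp]
theorem barHomotopy_consT_one (n : ℕ) (u : ⨂[k]^n A) :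
    barHomotopy ε (n + 1) (consT k n 1 u) = consT k (n + 1) 1 (consT k n 1 u) := by
  simp [barHomotopy_consT]

theorem barHomotopy_consT_of_aug {a : A} (ha : ε a = 0) (n : ℕ) (u : ⨂[k]^n A) :
    barHomotopy ε (n + 1) (consT k n a u) = - consT k (n + 1) a (barHomotopy ε n u) := by
  simp [barHomotopy_consT, ha, augProj_of_aug_eq_zero]

theorem barRight_consT_one (n : ℕ) (u : ⨂[k]^(n + 1) A) :
    barRight ε (n + 1) (consT k (n + 1) 1 u) = u - consT k n 1 (barRight ε n u) := by
  cases n with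
  | zero => simp [barRight, bPrime_zero_consT_one, sub_eq_add_neg]
  | succ n =>
    simp only [barRight, LinearMap.add_apply, LinearMap.smul_apply, bPrime_consT_one,
      augLast_succ_consT, map_add, LinearMap.map_smul]
    rw [pow_succ _ (n + 1), mul_neg_one, neg_smul]
    abel

theorem barBoth_zero : barBoth ε 0 = 0 := by
  simp [barBoth, barRight, augLast]

theorem barBoth_consT_one (n : ℕ) (u : ⨂[k]^(n + 1) A) :
    barBoth ε (n + 1) (consT k (n + 1) 1 u) = consT k n 1 (barRight ε n u) := by
  rw [barBoth, LinearMap.sub_apply, barRight_consT_one, augFirst_consT, map_one, one_smul]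
  abel

theorem barRight_consT_of_aug (hε : ∀ x y : A, ε x = 0 → ε y = 0 → x * y = 0) {a : A}
    (ha : ε a = 0) (n : ℕ) (u : ⨂[k]^(n + 1) A) :
    barRight ε (n + 1) (consT k (n + 1) a u) = consT k n a (barBoth ε n u) := by
  -- Since `a` annihilates the ideal, multiplying `a` into the next factor `c` gives `ε(c) a`.
  have h0 : ∀ (n : ℕ) (u : ⨂[k]^(n + 1) A),
      face k A n 0 (consT k (n + 1) a u) = consT k n a (augFirst ε n u) := by
    intro n u
    refine DFunLike.congr_fun (f := face k A n 0 ∘ₗ consT k (n + 1) a)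
      (g := consT k n a ∘ₗ augFirst ε n) (aug_ext ε (fun x => ?_) fun c x hc => ?_) u
    · simp [face_zero_consT]
    · simp [face_zero_consT, hε a c ha hc, hc]
  cases n with
  | zero => simp [barRight, bPrime_zero, h0, barBoth, sub_eq_add_neg]
  | succ n =>
    rw [barBoth, barRight, barRight]
    simp only [LinearMap.add_apply, LinearMap.sub_apply, LinearMap.smul_apply, bPrime_succ_consT,
      augLast_succ_consT, map_add, map_sub, LinearMap.map_smul, h0]
    rw [pow_succ _ (n + 1), mul_neg_one, neg_smul]
    abel

theorem barBoth_consT_of_aug (hε : ∀ x y : A, ε x = 0 → ε y = 0 → x * y = 0) {a : A}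
    (ha : ε a = 0) (n : ℕ) (u : ⨂[k]^(n + 1) A) :
    barBoth ε (n + 1) (consT k (n + 1) a u) = - consT k n a (barBoth ε n u) := by
  rw [barBoth, LinearMap.sub_apply, barRight_consT_of_aug ε hε ha, augFirst_consT, ha, zero_smul,
    zero_sub]

/-- `h` is a homotopy between the identity and the projection onto the tensors over the
augmentation ideal. -/
theorem barBoth_barHomotopy (hε : ∀ x y : A, ε x = 0 → ε y = 0 → x * y = 0) (n : ℕ)
    (u : ⨂[k]^(n + 1) A) :
    barBoth ε (n + 1) (barHomotopy ε (n + 1) u) + barHomotopy ε n (barBoth ε n u) =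
      u - tensorProj ε (n + 1) u := by
  induction n with
  | zero =>
    refine DFunLike.congr_fun (f := barBoth ε 1 ∘ₗ barHomotopy ε 1 +
      barHomotopy ε 0 ∘ₗ barBoth ε 0) (g := LinearMap.id - tensorProj ε 1)
      (aug_ext ε (fun x => ?_) fun a x ha => ?_) u
    · simp [barBoth_consT_one, barBoth_zero, barRight]
    · simp [ha, barBoth_zero, barHomotopy, augProj_of_aug_eq_zero ε ha, tensorProj]
  | succ n ih =>
    refine DFunLike.congr_fun (f := barBoth ε (n + 2) ∘ₗ barHomotopy ε (n + 2) +
      barHomotopy ε (n + 1) ∘ₗ barBoth ε (n + 1)) (g := LinearMap.id - tensorProj ε (n + 2))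
      (aug_ext ε (fun x => ?_) fun a x ha => ?_) u
    · simp [barBoth_consT_one, barRight_consT_one]
    · simp only [LinearMap.add_apply, LinearMap.comp_apply, LinearMap.sub_apply, LinearMap.id_apply,
        barHomotopy_consT_of_aug ε ha, barBoth_consT_of_aug ε hε ha, map_neg, neg_neg,
        tensorProj_consT, augProj_of_aug_eq_zero ε ha, ← map_add, ih, map_sub]

/-- An ideal factor in front passes through `barBoth` up to sign, and a tensor starting with `1` is
sent to one starting with `1`, which the projection kills. So nonzero tensors over the ideal are
never boundaries. -/
theorem tensorProj_barBoth (hε : ∀ x y : A, ε x = 0 → ε y = 0 → x * y = 0) (n : ℕ)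
    (u : ⨂[k]^(n + 1) A) : tensorProj ε n (barBoth ε n u) = 0 := by
  induction n with
  | zero => simp [barBoth_zero]
  | succ n ih =>
    refine DFunLike.congr_fun (f := tensorProj ε (n + 1) ∘ₗ barBoth ε (n + 1)) (g := 0)
      (aug_ext ε (fun x => ?_) fun a x ha => ?_) u
    · simp [barBoth_consT_one]
    · simp [barBoth_consT_of_aug ε hε ha, ih]

/-! ### The Hochschild complex -/

/-- This exhibits the subcomplex `I ⊗ B` of the Hochschild complex. The last face multiplies some
`c` into `a` from the left, which again gives `ε(c) a`. -/
theorem b_consT_of_aug (hε : ∀ x y : A, ε x = 0 → ε y = 0 → x * y = 0) {a : A}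
    (ha : ε a = 0) (n : ℕ) (u : ⨂[k]^(n + 1) A) :
    b k A n (consT k (n + 1) a u) = consT k n a (barBoth ε n u) := by
  have h : lastFace k A n (consT k (n + 1) a u) = consT k n a (augLast ε n u) := by
    refine DFunLike.congr_fun (f := lastFace k A n ∘ₗ consT k (n + 1) a)
      (g := consT k n a ∘ₗ augLast ε n) (tprod_ext k fun x => ?_) u
    rw [LinearMap.comp_apply, LinearMap.comp_apply, lastFace_consT, augLast_tprod,
      eq_smul_one_add_augProj ε (x (Fin.last n)), add_mul, hε _ _ (aug_augProj ε _) ha]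
    simp
  rw [← barRight_consT_of_aug ε hε ha, b, barRight]
  simp [h]

theorem augFirst_t (n : ℕ) (u : ⨂[k]^(n + 1) A) :
    augFirst ε n (t k A n u) = (-1 : k) ^ n • augLast ε n u := by
  refine DFunLike.congr_fun (f := augFirst ε n ∘ₗ t k A n) (g := (-1 : k) ^ n • augLast ε n)
    (tprod_ext k fun x => ?_) u
  rw [LinearMap.comp_apply, LinearMap.smul_apply, t, LinearMap.smul_apply, rot_consT_tprod,
    map_smul, augFirst_consT, augLast_tprod]

/-- This identifies the quotient by `I ⊗ B` with `B`. The case that matters is `b(1 ⊗ u) = (1 - t)u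
- 1 ⊗ b'u`, where `augFirst ∘ t` supplies the last term of `barBoth`. -/
theorem augFirst_b (hε : ∀ x y : A, ε x = 0 → ε y = 0 → x * y = 0) (n : ℕ)
    (y : ⨂[k]^(n + 2) A) :
    augFirst ε n (b k A n y) = barBoth ε n (augFirst ε (n + 1) y) := by
  refine DFunLike.congr_fun (f := augFirst ε n ∘ₗ b k A n) (g := barBoth ε n ∘ₗ augFirst ε (n + 1))
      (aug_ext ε (fun u => ?_) fun a u ha => ?_) y
  · simp only [LinearMap.comp_apply, augFirst_consT, map_one, one_smul]
    cases n with
    | zero =>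
      rw [b_zero_consT_one, map_sub, augFirst_t, barBoth, LinearMap.sub_apply, barRight]
      simp
    | succ n =>
      rw [b_consT_one, map_sub, map_sub, augFirst_t, barBoth, LinearMap.sub_apply, barRight,
        augFirst_consT, map_one, one_smul, LinearMap.add_apply, LinearMap.smul_apply]
      abel
  · simp [b_consT_of_aug ε hε ha, ha]

/-- The contraction of `B` tensored with `I`; the condition on `y` says that it lies in `I ⊗ B`. -/
theorem b_hochHomotopy (hε : ∀ x y : A, ε x = 0 → ε y = 0 → x * y = 0) (n : ℕ)
    (y : ⨂[k]^(n + 2) A) (hy : augFirst ε (n + 1) y = 0) :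
    b k A (n + 1) (hochHomotopy ε (n + 1) y) + hochHomotopy ε n (b k A n y) =
      y - tensorProj ε (n + 2) y := by
  -- Composing with the projection `1 - 1 ⊗ augFirst` onto `I ⊗ B` gives an identity valid for all
  -- tensors. The first term needs no projection, as `hochHomotopy` kills tensors starting with `1`.
  have h := DFunLike.congr_fun (f := b k A (n + 1) ∘ₗ hochHomotopy ε (n + 1) +
    hochHomotopy ε n ∘ₗ b k A n ∘ₗ (LinearMap.id - consT k (n + 1) 1 ∘ₗ augFirst ε (n + 1)))
    (g := LinearMap.id - consT k (n + 1) 1 ∘ₗ augFirst ε (n + 1) - tensorProj ε (n + 2))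
      (aug_ext ε (fun u => ?_) fun a u ha => ?_) y
  · simpa [hy] using h
  · simp
  · simp only [LinearMap.add_apply, LinearMap.comp_apply, LinearMap.sub_apply, LinearMap.id_apply,
      augFirst_consT, ha, zero_smul, map_zero, sub_zero, hochHomotopy_consT,
      augProj_of_aug_eq_zero ε ha, b_consT_of_aug ε hε ha, ← map_add, barBoth_barHomotopy ε hε,
      tensorProj_consT, map_sub]

end Augmented

/-! ### Augmentation and coordinates of `k[x₁, …, x_d] / 𝔪²` -/

section SqZero

variable (k : Type*) [CommRing k] (d : ℕ)

theorem mono_zero : mono k d 0 = 1 := by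
  simp [mono]

theorem mono_eq_zero {e : Fin d →₀ ℕ} (h : 2 ≤ e.degree) : mono k d e = 0 := by
  rw [mono, Ideal.Quotient.eq_zero_iff_mem, MvPolynomial.mem_pow_idealOfVars_iff']
  intro x hx
  rw [MvPolynomial.coeff_monomial, if_neg]
  rintro rfl
  omega

/-- The augmentation `k[x₁, …, x_d] / 𝔪² → k`. -/
def aug : SqZero k d →ₐ[k] k :=
  Ideal.Quotient.liftₐ _ (MvPolynomial.aeval fun _ => 0) fun p hp => by
    rw [MvPolynomial.mem_pow_idealOfVars_iff'] at hp
    rw [show (fun _ : Fin d => (0 : k)) = 0 from rfl, MvPolynomial.aeval_zero,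
      MvPolynomial.constantCoeff_eq, hp 0 (by simp), map_zero]

theorem aug_mk (p : MvPolynomial (Fin d) k) :
    aug k d (Ideal.Quotient.mk _ p) = p.coeff 0 := by
  rw [← MvPolynomial.constantCoeff_eq]
  change MvPolynomial.aeval (0 : Fin d → k) p = _
  rw [MvPolynomial.aeval_zero]
  rfl

theorem aug_mono_single (j : Fin d) : aug k d (mono k d (Finsupp.single j 1)) = 0 := by
  rw [mono, aug_mk, MvPolynomial.coeff_monomial, if_neg]
  simp

theorem mul_eq_zero_of_aug (x y : SqZero k d) (hx : aug k d x = 0) (hy : aug k d y = 0) :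
    x * y = 0 := by
  obtain ⟨p, rfl⟩ := Ideal.Quotient.mk_surjective x
  obtain ⟨q, rfl⟩ := Ideal.Quotient.mk_surjective y
  rw [aug_mk] at hx hy
  have h : ∀ p : MvPolynomial (Fin d) k, p.coeff 0 = 0 →
      p ∈ MvPolynomial.idealOfVars (Fin d) k := by
    intro p hp
    rw [← pow_one (MvPolynomial.idealOfVars (Fin d) k), MvPolynomial.mem_pow_idealOfVars_iff']
    intro x hx
    rw [Nat.lt_one_iff, Finsupp.degree_eq_zero_iff] at hx
    rw [hx, hp]
  rw [← map_mul, Ideal.Quotient.eq_zero_iff_mem, pow_two]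
  exact Ideal.mul_mem_mul (h p hx) (h q hy)

/-- The coefficient of `xⱼ`. -/
def coeffVar (j : Fin d) : SqZero k d →ₗ[k] k :=
  Submodule.liftQ ((MvPolynomial.idealOfVars (Fin d) k ^ 2).restrictScalars k)
      (MvPolynomial.lcoeff k (Finsupp.single j 1)) (fun p hp => by
        have hp' : p ∈ MvPolynomial.idealOfVars (Fin d) k ^ 2 := hp
        rw [MvPolynomial.mem_pow_idealOfVars_iff'] at hp'
        exact hp' _ (by simp)) ∘ₗ
    (Submodule.Quotient.restrictScalarsEquiv k
      (MvPolynomial.idealOfVars (Fin d) k ^ 2)).symm.toLinearMap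

theorem coeffVar_mono_single (i j : Fin d) :
    coeffVar k d i (mono k d (Finsupp.single j 1)) = if i = j then 1 else 0 := by
  refine (MvPolynomial.coeff_monomial _ _ _).trans ?_
  refine if_congr ?_ rfl rfl
  rw [Finsupp.single_left_inj one_ne_zero, eq_comm]

end SqZero

/-! ### Weights -/

section TensorWeight

variable (k : Type*) [CommRing k] (d : ℕ)

/-- The part of weight `w` of `A^{⊗ n}`. -/
def tensorWeight (w n : ℕ) : Submodule k (⨂[k]^n (SqZero k d)) :=
  Submodule.span k
    {x | ∃ e : Fin n → (Fin d →₀ ℕ), ∑ i, (e i).degree = w ∧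
      x = PiTensorProduct.tprod k (fun i => mono k d (e i))}

variable {k d}

theorem consT_mono_mem {w n : ℕ} (e : Fin d →₀ ℕ) {u : ⨂[k]^n (SqZero k d)}
    (hu : u ∈ tensorWeight k d w n) :
    consT k n (mono k d e) u ∈ tensorWeight k d (e.degree + w) (n + 1) := by
  induction hu using Submodule.span_induction with
  | mem x h =>
    obtain ⟨f, hf, rfl⟩ := h
    refine Submodule.subset_span ⟨Fin.cons e f, ?_, ?_⟩
    · simp [Fin.sum_univ_succ, hf]
    · rw [consT_tprod]
      congr 1
      funext i
      refine Fin.cases ?_ (fun i => ?_) i <;> simp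
  | zero => simp
  | add x y _ _ hx hy => rw [map_add]; exact add_mem hx hy
  | smul c x _ hx => rw [map_smul]; exact Submodule.smul_mem _ c hx

theorem consT_one_mem {w n : ℕ} {u : ⨂[k]^n (SqZero k d)} (hu : u ∈ tensorWeight k d w n) :
    consT k n 1 u ∈ tensorWeight k d w (n + 1) := by
  simpa [mono_zero] using consT_mono_mem 0 hu

theorem consT_var_mem {w n : ℕ} (j : Fin d) {u : ⨂[k]^n (SqZero k d)}
    (hu : u ∈ tensorWeight k d w n) :
    consT k n (mono k d (Finsupp.single j 1)) u ∈ tensorWeight k d (w + 1) (n + 1) := by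
  simpa [add_comm] using consT_mono_mem (Finsupp.single j 1) hu

/-- The first monomial has degree 0, degree 1, or is zero in the quotient. With `P = ⊥` this proves
vanishing statements. -/
theorem tensorWeight_cons_induction {w n : ℕ} {M : Type*} [AddCommGroup M] [Module k M]
    (f : (⨂[k]^(n + 1) (SqZero k d)) →ₗ[k] M) (P : Submodule k M)
    (h1 : ∀ u ∈ tensorWeight k d w n, f (consT k n 1 u) ∈ P)
    (h2 : ∀ j w', w' + 1 = w → ∀ u ∈ tensorWeight k d w' n,
      f (consT k n (mono k d (Finsupp.single j 1)) u) ∈ P)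
    {x} (hx : x ∈ tensorWeight k d w (n + 1)) : f x ∈ P := by
  induction hx using Submodule.span_induction with
  | mem x h =>
    obtain ⟨e, he, rfl⟩ := h
    have hx : PiTensorProduct.tprod k (fun i => mono k d (e i)) = consT k n (mono k d (e 0))
        (PiTensorProduct.tprod k (fun i : Fin n => mono k d (e i.succ))) := by
      rw [consT_tprod]
      congr 1
      funext i
      refine Fin.cases ?_ (fun i => ?_) i <;> simp
    rw [Fin.sum_univ_succ] at he
    rw [hx]
    rcases lt_trichotomy (e 0).degree 1 with h | h | h
    · rw [Nat.lt_one_iff] at h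
      rw [h, zero_add] at he
      rw [Finsupp.degree_eq_zero_iff] at h
      rw [h, mono_zero]
      exact h1 _ (Submodule.subset_span ⟨_, he, rfl⟩)
    · obtain ⟨j, hj⟩ : e 0 ∈ Set.range fun a : Fin d => Finsupp.single a 1 := by
        rw [Finsupp.range_single_one]; exact h
      rw [← hj]
      rw [h, add_comm] at he
      exact h2 j _ he _ (Submodule.subset_span ⟨_, rfl, rfl⟩)
    · rw [mono_eq_zero k d h]
      simp
  | zero => simp
  | add x y _ _ hx hy => rw [map_add]; exact add_mem hx hy
  | smul c x _ hx => rw [map_smul]; exact Submodule.smul_mem _ c hx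

/-- A nonzero monomial carries at most one variable. This bounds the weight `w` bicomplex from
below. -/
theorem eq_zero_of_mem_tensorWeight {w n : ℕ} (h : n < w) {x : ⨂[k]^n (SqZero k d)}
    (hx : x ∈ tensorWeight k d w n) : x = 0 := by
  induction n generalizing w with
  | zero =>
    refine (Submodule.mem_bot k).1 ((Submodule.span_le (p := ⊥)).2 ?_ hx)
    rintro _ ⟨e, he, rfl⟩
    simp at he
    omega
  | succ n ih =>
    refine (Submodule.mem_bot k).1
      (tensorWeight_cons_induction LinearMap.id ⊥ (fun u hu => ?_) (fun j w' hw u hu => ?_) hx)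
    · simp [ih (by omega) hu]
    · simp [ih (by omega) hu]

theorem augFirst_mem {w n : ℕ} {x} (hx : x ∈ tensorWeight k d w (n + 1)) :
    augFirst (aug k d) n x ∈ tensorWeight k d w n := by
  refine tensorWeight_cons_induction _ _ (fun u hu => ?_) (fun j w' hw u hu => ?_) hx
  · simpa using hu
  · simp [aug_mono_single]

theorem barHomotopy_mem {w n : ℕ} {x} (hx : x ∈ tensorWeight k d w n) :
    barHomotopy (aug k d) n x ∈ tensorWeight k d w (n + 1) := by
  induction n generalizing w with
  | zero => simp [barHomotopy]
  | succ n ih =>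
    refine tensorWeight_cons_induction _ _ (fun u hu => ?_) (fun j w' hw u hu => ?_) hx
    · simpa using consT_one_mem (consT_one_mem hu)
    · rw [barHomotopy_consT_of_aug _ (aug_mono_single k d j), ← hw]
      exact neg_mem (consT_var_mem j (ih hu))

theorem hochHomotopy_mem {w n : ℕ} {x} (hx : x ∈ tensorWeight k d w (n + 1)) :
    hochHomotopy (aug k d) n x ∈ tensorWeight k d w (n + 2) := by
  refine tensorWeight_cons_induction _ _ (fun u hu => ?_) (fun j w' hw u hu => ?_) hx
  · simp
  · rw [hochHomotopy_consT, augProj_of_aug_eq_zero _ (aug_mono_single k d j), ← hw]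
    exact consT_var_mem j (barHomotopy_mem hu)

/-- With as many variables as factors there is no factor `1` to double. -/
theorem barHomotopy_eq_zero {n : ℕ} {x} (hx : x ∈ tensorWeight k d n n) :
    barHomotopy (aug k d) n x = 0 := by
  induction n with
  | zero => simp [barHomotopy]
  | succ n ih =>
    refine (Submodule.mem_bot k).1
      (tensorWeight_cons_induction _ ⊥ (fun u hu => ?_) (fun j w' hw u hu => ?_) hx)
    · simp [eq_zero_of_mem_tensorWeight (Nat.lt_succ_self n) hu]
    · obtain rfl : w' = n := by omega
      simp [barHomotopy_consT, ih hu, aug_mono_single]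

theorem hochHomotopy_eq_zero {n : ℕ} {x} (hx : x ∈ tensorWeight k d (n + 1) (n + 1)) :
    hochHomotopy (aug k d) n x = 0 := by
  refine (Submodule.mem_bot k).1
    (tensorWeight_cons_induction _ ⊥ (fun u hu => ?_) (fun j w' hw u hu => ?_) hx)
  · simp
  · obtain rfl : w' = n := by omega
    simp [barHomotopy_eq_zero hu]

/-- With fewer variables than factors some factor is `1`, and the projection kills it. -/
theorem tensorProj_eq_zero {w n : ℕ} (h : w < n) {x} (hx : x ∈ tensorWeight k d w n) :
    tensorProj (aug k d) n x = 0 := by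
  induction n generalizing w with
  | zero => omega
  | succ n ih =>
    refine (Submodule.mem_bot k).1
      (tensorWeight_cons_induction _ ⊥ (fun u hu => ?_) (fun j w' hw u hu => ?_) hx)
    · simp
    · simp [ih (by omega) hu]

theorem tensorProj_eq_self {n : ℕ} {x} (hx : x ∈ tensorWeight k d n n) :
    tensorProj (aug k d) n x = x := by
  induction n with
  | zero => simp [tensorProj]
  | succ n ih =>
    refine sub_eq_zero.1 ((Submodule.mem_bot k).1 (tensorWeight_cons_induction
      (tensorProj (aug k d) (n + 1) - LinearMap.id) ⊥ (fun u hu => ?_)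
      (fun j w' hw u hu => ?_) hx))
    · simp [eq_zero_of_mem_tensorWeight (Nat.lt_succ_self n) hu]
    · obtain rfl : w' = n := by omega
      simp [ih hu, augProj_of_aug_eq_zero _ (aug_mono_single k d j)]

theorem augLast_eq_zero {n : ℕ} {x} (hx : x ∈ tensorWeight k d (n + 1) (n + 1)) :
    augLast (aug k d) n x = 0 := by
  induction n with
  | zero =>
    refine (Submodule.mem_bot k).1
      (tensorWeight_cons_induction _ ⊥ (fun u hu => ?_) (fun j w' hw u hu => ?_) hx)
    · simp [eq_zero_of_mem_tensorWeight Nat.zero_lt_one hu]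
    · simp [aug_mono_single]
  | succ n ih =>
    refine (Submodule.mem_bot k).1
      (tensorWeight_cons_induction _ ⊥ (fun u hu => ?_) (fun j w' hw u hu => ?_) hx)
    · simp [eq_zero_of_mem_tensorWeight (Nat.lt_succ_self _) hu]
    · obtain rfl : w' = n + 1 := by omega
      simp [ih hu]

/-! ### Exactness of the columns above the bottom row -/

/-- A diagram chase in `I ⊗ B → C → B`: in these rows there are more factors than variables, so
`tensorProj` vanishes and the homotopies contract both outer complexes. -/
theorem exists_b_eq {w j : ℕ} (hw : w ≤ j) {r} (hr : r ∈ weight k d w (j + 1))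
    (h : b k (SqZero k d) j r = 0) :
    ∃ r' ∈ weight k d w (j + 2), b k (SqZero k d) (j + 1) r' = r := by
  have hε := mul_eq_zero_of_aug k d
  set u := augFirst (aug k d) (j + 1) r with hu
  have hum : u ∈ tensorWeight k d w (j + 1) := augFirst_mem hr
  have h1 := barBoth_barHomotopy (aug k d) hε j u
  rw [← augFirst_b (aug k d) hε, h, map_zero, map_zero, add_zero,
    tensorProj_eq_zero (by omega) hum, sub_zero] at h1
  -- `c` lifts a primitive of the image of `r` in `B`, so `r - b c` is a cycle in `I ⊗ B`.
  set c := consT k (j + 2) 1 (barHomotopy (aug k d) (j + 1) u) with hc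
  have hcm : c ∈ weight k d w (j + 2) := consT_one_mem (barHomotopy_mem hum)
  have h2 := b_hochHomotopy (aug k d) hε j (r - b k (SqZero k d) (j + 1) c) (by
    rw [map_sub, augFirst_b (aug k d) hε, hc, augFirst_consT, map_one, one_smul, h1, sub_self])
  have hbb : b k (SqZero k d) j (b k (SqZero k d) (j + 1) c) = 0 :=
    DFunLike.congr_fun (b_b k (SqZero k d) j) c
  have hrm : r - b k (SqZero k d) (j + 1) c ∈ weight k d w (j + 1) :=
    sub_mem hr (b_mem_weight k d w _ hcm)
  have h0 : b k (SqZero k d) j (r - b k (SqZero k d) (j + 1) c) = 0 := by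
    rw [map_sub, h, hbb, sub_zero]
  rw [h0, map_zero, add_zero,
    tensorProj_eq_zero (by omega) hrm, sub_zero] at h2
  exact ⟨c + hochHomotopy (aug k d) (j + 1) (r - b k (SqZero k d) (j + 1) c),
    add_mem hcm (hochHomotopy_mem hrm), by rw [map_add, h2]; abel⟩

/-- No cycle condition is needed here: `b y` lies in the row where every factor is a variable, and
`hochHomotopy` vanishes there. -/
theorem exists_b_eq_of_augFirst {w' : ℕ} {y} (hy : y ∈ weight k d (w' + 1) (w' + 1))
    (h : augFirst (aug k d) (w' + 1) y = 0) :
    ∃ y' ∈ weight k d (w' + 1) (w' + 2), b k (SqZero k d) (w' + 1) y' = y := by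
  have h2 := b_hochHomotopy (aug k d) (mul_eq_zero_of_aug k d) w' y h
  rw [hochHomotopy_eq_zero (b_mem_weight k d _ _ hy), add_zero,
    tensorProj_eq_zero (by omega) hy, sub_zero] at h2
  exact ⟨_, hochHomotopy_mem hy, h2⟩

/-- All factors of `z` are variables, so the rotation puts a variable in front. -/
theorem augFirst_t_consT_one {w' : ℕ} {z} (hz : z ∈ weight k d (w' + 1) w') :
    augFirst (aug k d) (w' + 1) (t k (SqZero k d) (w' + 1) (consT k (w' + 1) 1 z)) = 0 := by
  rw [augFirst_t, augLast_succ_consT, augLast_eq_zero hz, map_zero, smul_zero]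

/-- In the bottom row of the truncated Hochschild column, every chain is the sum of a boundary and
some `(1 - t)x`. -/
theorem exists_b_add_eq {w' : ℕ} {y} (hy : y ∈ weight k d (w' + 1) (w' + 1)) :
    ∃ a ∈ weight k d (w' + 1) (w' + 1), ∃ y' ∈ weight k d (w' + 1) (w' + 2),
      b k (SqZero k d) (w' + 1) y' + (1 - t k (SqZero k d) (w' + 1)) a = y := by
  set z := augFirst (aug k d) (w' + 1) y with hz
  have hzm : z ∈ weight k d (w' + 1) w' := augFirst_mem hy
  set a := consT k (w' + 1) 1 z with ha
  have ham : a ∈ weight k d (w' + 1) (w' + 1) := consT_one_mem hzm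
  -- `a` accounts for the part of `y` that starts with `1`, and `t a` has no such part; so `y - (1 -
  -- t)a` lies in `I ⊗ B`.
  obtain ⟨y', hy', h⟩ := exists_b_eq_of_augFirst (y := y - a + t k (SqZero k d) (w' + 1) a)
    (add_mem (sub_mem hy ham) (t_mem_weight k d _ _ ham)) (by
      rw [map_add, augFirst_t_consT_one hzm, map_sub, ha, augFirst_consT, map_one, one_smul,
        ← hz, sub_self, add_zero])
  refine ⟨a, ham, y', hy', ?_⟩
  rw [h, LinearMap.sub_apply, Module.End.one_apply]
  abel

/-- Applying `augFirst` makes `z` a boundary in `B`; but `tensorProj` fixes `z` and kills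
boundaries. -/
theorem eq_zero_of_consT_one_eq_b {w' : ℕ} {z} (hz : z ∈ weight k d (w' + 1) w') {y}
    (h : consT k (w' + 1) 1 z = b k (SqZero k d) (w' + 1) y) : z = 0 := by
  have h1 := congrArg (augFirst (aug k d) (w' + 1)) h
  rw [augFirst_b _ (mul_eq_zero_of_aug k d), augFirst_consT, map_one, one_smul] at h1
  rw [← tensorProj_eq_self hz, h1, tensorProj_barBoth _ (mul_eq_zero_of_aug k d)]

/-- In the bottom row of the truncated bar column, if `(1 - t)x` is a boundary, then so is `x`. -/
theorem exists_bPrime_eq {w' : ℕ} {x} (hx : x ∈ weight k d (w' + 1) (w' + 1)) {y}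
    (h : b k (SqZero k d) (w' + 1) y + (1 - t k (SqZero k d) (w' + 1)) x = 0) :
    ∃ x' ∈ weight k d (w' + 1) (w' + 2), bPrime k (SqZero k d) (w' + 1) x' = x := by
  set A := SqZero k d
  set z := bPrime k A w' x with hz
  have hzm : z ∈ weight k d (w' + 1) w' := bPrime_mem_weight k d _ _ hx
  set a := consT k (w' + 1) 1 z with ha
  have ham : a ∈ weight k d (w' + 1) (w' + 1) := consT_one_mem hzm
  obtain ⟨y', hy', h'⟩ := exists_b_eq_of_augFirst (t_mem_weight k d _ _ ham)
    (augFirst_t_consT_one hzm)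
  -- Modulo boundaries of `b'`, `x` is `a = 1 ⊗ b'x`; it remains to show `b'x = 0`.
  have h1 : bPrime k A (w' + 1) (consT k (w' + 2) 1 x) = x - a := bPrime_consT_one k w' x
  have h2 := DFunLike.congr_fun (b_one_sub_t k A (w' + 1)) (consT k (w' + 2) 1 x)
  rw [LinearMap.comp_apply, LinearMap.comp_apply, h1, map_sub] at h2
  -- `a` is the sum of `(1 - t)x`, `t a` and `-(1 - t)b'(1 ⊗ x) = -b(1 - t)(1 ⊗ x)`, all of which
  -- are boundaries of `b`.
  have h3 : a = b k A (w' + 1) (y' - y - (1 - t k A (w' + 2)) (consT k (w' + 2) 1 x)) := by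
    rw [map_sub, map_sub, h', h2, eq_neg_of_add_eq_zero_left h, LinearMap.sub_apply,
      LinearMap.sub_apply, Module.End.one_apply, Module.End.one_apply]
    abel
  refine ⟨consT k (w' + 2) 1 x, consT_one_mem hx, ?_⟩
  rw [h1, ha, eq_zero_of_consT_one_eq_b hzm h3, map_zero, sub_zero]

end TensorWeight

/-! ### Reduction of the total complex to its bottom row -/

section Reduction

variable (k : Type*) [CommRing k]

theorem vert_horiz {A : Type*} [Ring A] [Algebra k A] (p : ℤ) (q : ℕ) (x : ⨂[k]^(q + 2) A) :
    vert k A (p - 1) q (horiz k A p (q + 1) x) = - horiz k A p q (vert k A p q x) := by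
  by_cases hp : Even p
  · have hm : ¬ Even (p - 1) := by rw [Int.even_sub_one]; simpa using hp
    rw [vert, horiz, horiz, vert, if_neg hm, if_pos hp, if_pos hp, if_pos hp]
    exact congrArg Neg.neg (DFunLike.congr_fun (bPrime_N k A q) x)
  · have hm : Even (p - 1) := by rw [Int.even_sub_one]; exact hp
    rw [vert, horiz, horiz, vert, if_pos hm, if_neg hp, if_neg hp, if_neg hp, LinearMap.neg_apply,
      map_neg, neg_neg]
    exact DFunLike.congr_fun (b_one_sub_t k A q) x

theorem horiz_horiz {A : Type*} [Ring A] [Algebra k A] (p : ℤ) (q : ℕ) (x : ⨂[k]^(q + 1) A) :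
    horiz k A p q (horiz k A (p + 1) q x) = 0 := by
  by_cases hp : Even p
  · have hm : ¬ Even (p + 1) := by rw [Int.even_add_one]; simpa using hp
    rw [horiz, horiz, if_neg hm, if_pos hp, LinearMap.sub_apply, map_sub, Module.End.one_apply,
      ← Module.End.mul_apply, N_t, sub_self]
  · have hm : Even (p + 1) := by rw [Int.even_add_one]; exact hp
    rw [horiz, horiz, if_pos hm, if_neg hp, LinearMap.sub_apply, Module.End.one_apply,
      ← Module.End.mul_apply, t_N, sub_self]

variable {k} {d : ℕ}

theorem exists_vert_eq {w j : ℕ} (hw : w ≤ j) (p : ℤ) {r} (hr : r ∈ weight k d w (j + 1))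
    (h : vert k (SqZero k d) p j r = 0) :
    ∃ r' ∈ weight k d w (j + 2), vert k (SqZero k d) p (j + 1) r' = r := by
  by_cases hp : Even p
  · simp only [vert, if_pos hp] at h ⊢
    exact exists_b_eq hw hr h
  · simp only [vert, if_neg hp, LinearMap.neg_apply, neg_eq_zero] at h ⊢
    refine ⟨- consT k (j + 2) 1 r, neg_mem (consT_one_mem hr), ?_⟩
    rw [map_neg, bPrime_consT_one, h, map_zero, sub_zero, neg_neg]

/-- Exactness of the row of column cokernels, on which `1 - t` is bijective. For odd `p` injectivity
already makes `x` a vertical boundary, so `a = 0`. -/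
theorem exists_vert_add_horiz_eq {w' : ℕ} (p : ℤ) {x} (hx : x ∈ weight k d (w' + 1) (w' + 1)) {y}
    (h : vert k (SqZero k d) (p - 1) (w' + 1) y + horiz k (SqZero k d) p (w' + 1) x = 0) :
    ∃ a ∈ weight k d (w' + 1) (w' + 1), ∃ e ∈ weight k d (w' + 1) (w' + 2),
      vert k (SqZero k d) p (w' + 1) e + horiz k (SqZero k d) (p + 1) (w' + 1) a = x := by
  by_cases hp : Even p
  · have hm : ¬ Even (p + 1) := by rw [Int.even_add_one]; simpa using hp
    simp only [vert, horiz, if_pos hp, if_neg hm]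
    exact exists_b_add_eq hx
  · have hm : Even (p - 1) := by rw [Int.even_sub_one]; exact hp
    simp only [vert, horiz, if_pos hm, if_neg hp] at h ⊢
    obtain ⟨x', hx', h'⟩ := exists_bPrime_eq hx h
    refine ⟨0, zero_mem _, -x', neg_mem hx', ?_⟩
    rw [map_neg, LinearMap.neg_apply, neg_neg, h', map_zero, add_zero]

/-- The equation is solved row by row upwards using exact columns. Infinitely many nonzero rows are
allowed because the total complex is a product. -/
theorem exists_D_eq_of_apply_eq_zero {w : ℕ} {n : ℤ} {c : Tot k (SqZero k d)}
    (hc : c ∈ totWeight k d w) (h : ∀ q, w ≤ q → D k (SqZero k d) n c q = 0) (h0 : c w = 0) :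
    ∃ e ∈ totWeight k d w, ∀ q, w ≤ q → D k (SqZero k d) (n + 1) e q = c q := by
  classical
  set A := SqZero k d
  -- A vertical preimage chosen for every `r`, with the default 0 when there is none.
  have hK : ∀ (q : ℕ) (r : ⨂[k]^(q + 1) A), ∃ r' ∈ weight k d w (q + 1),
      (∃ r'' ∈ weight k d w (q + 1), vert k A (n - q) q r'' = r) → vert k A (n - q) q r' = r := by
    intro q r
    by_cases hr : ∃ r'' ∈ weight k d w (q + 1), vert k A (n - q) q r'' = r
    · obtain ⟨r'', h1, h2⟩ := hr
      exact ⟨r'', h1, fun _ => h2⟩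
    · exact ⟨0, zero_mem _, fun h => absurd h hr⟩
  choose K hKm hK using hK
  -- Since `c w = 0`, rows up to `w + 1` may be zero; above them, `e (q + 1)` is chosen to satisfy
  -- the equation in row `q`.
  let e : Tot k A := fun q => Nat.rec (motive := fun q => ⨂[k]^(q + 1) A) 0
    (fun q x => if w < q then K q (c q - horiz k A (n + 1 - q) q x) else 0) q
  have e_succ : ∀ q, e (q + 1) =
      if w < q then K q (c q - horiz k A (n + 1 - q) q (e q)) else 0 := fun q => rfl
  have e_zero : ∀ q, q ≤ w + 1 → e q = 0 := by
    intro q hq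
    cases q with
    | zero => rfl
    | succ q => rw [e_succ, if_neg (by omega)]
  have hem : e ∈ totWeight k d w := by
    intro q _
    cases q with
    | zero => exact zero_mem _
    | succ q =>
      change e (q + 1) ∈ weight k d w (q + 1)
      rw [e_succ]
      split_ifs
      · exact hKm _ _
      · exact zero_mem _
  refine ⟨e, hem, fun q hq => ?_⟩
  rw [D_apply, show n + 1 - ((q : ℤ) + 1) = n - q by ring]
  induction q, hq using Nat.le_induction with
  | base => rw [e_zero _ le_rfl, e_zero _ (Nat.le_succ w), map_zero, map_zero, add_zero, h0]
  | succ j hj ih =>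
    rw [← eq_sub_iff_add_eq, e_succ (j + 1), if_pos (by omega)]
    refine hK _ _ (exists_vert_eq hj _ ?_ ?_)
    · refine sub_mem (hc _ trivial) ?_
      rw [horiz]
      split_ifs
      · exact N_mem_weight k d w _ (hem _ trivial)
      · exact sub_mem (hem _ trivial) (t_mem_weight k d w _ (hem _ trivial))
    -- The remainder is a vertical cycle: this combines the cycle condition on `c` in row `j` with
    -- the equation already solved there.
    · have h1 := h j hj
      rw [D_apply] at h1
      have h2 := vert_horiz k (n - j) j (e (j + 1))
      rw [eq_sub_iff_add_eq.2 ih, map_sub, show n + 1 - (j : ℤ) = n - j + 1 by ring,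
        horiz_horiz, sub_zero] at h2
      push_cast
      rw [map_sub, show n + 1 - ((j : ℤ) + 1) = n - j by ring,
        show n - ((j : ℤ) + 1) = n - j - 1 by ring, h2, sub_neg_eq_add,
        ← show n - ((j : ℤ) + 1) = n - j - 1 by ring, h1]

/-- The rows `q ≥ w` of the part of weight `w > 0` form an acyclic quotient complex. -/
theorem exists_D_eq {w' : ℕ} {n : ℤ} {c : Tot k (SqZero k d)}
    (hc : c ∈ totWeight k d (w' + 1))
    (h : ∀ q, w' + 1 ≤ q → D k (SqZero k d) n c q = 0) :
    ∃ e ∈ totWeight k d (w' + 1), ∀ q, w' + 1 ≤ q → D k (SqZero k d) (n + 1) e q = c q := by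
  classical
  set A := SqZero k d
  have h1 := h (w' + 1) le_rfl
  rw [D_apply, ← sub_sub] at h1
  obtain ⟨a, ha, e, he, hae⟩ := exists_vert_add_horiz_eq _ (hc _ trivial) h1
  -- With `a` and `e` in the two lowest remaining rows, `D f` agrees with `c` in row `w' + 1`.
  let f : Tot k A := Pi.single (w' + 1) a + Pi.single (w' + 2) e
  have hf : f ∈ totWeight k d (w' + 1) := by
    refine add_mem (fun q _ => ?_) (fun q _ => ?_)
    · rcases eq_or_ne q (w' + 1) with rfl | hq
      · rw [Pi.single_eq_same]; exact ha
      · rw [Pi.single_eq_of_ne hq]; exact zero_mem _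
    · rcases eq_or_ne q (w' + 2) with rfl | hq
      · rw [Pi.single_eq_same]; exact he
      · rw [Pi.single_eq_of_ne hq]; exact zero_mem _
  have f1 : f (w' + 1) = a := by simp [f]
  have f2 : f (w' + 1 + 1) = e := by simp [f]
  obtain ⟨g, hg, hgc⟩ := exists_D_eq_of_apply_eq_zero (n := n) (c := c - D k A (n + 1) f)
    (sub_mem hc (D_mem_totWeight k d _ _ f hf)) (fun q hq => by
      rw [map_sub, D_D, sub_zero, h q hq]) (by
      rw [Pi.sub_apply, D_apply, f1, f2, ← hae, sub_eq_zero]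
      congr 3 <;> ring)
  refine ⟨f + g, add_mem hf hg, fun q hq => ?_⟩
  rw [map_add, Pi.add_apply, hgc q hq, Pi.sub_apply, add_sub_cancel]

end Reduction

/-! ### Words and their rotations -/

section WordRotation

open Function

variable {m d : ℕ}

theorem finRotate_symm_val (n : ℕ) (i : Fin n) :
    ((finRotate n).symm i : ℕ) = (i + (n - 1)) % n := by
  cases n with
  | zero => exact i.elim0
  | succ n =>
    refine Fin.cases ?_ (fun l => ?_) i
    · rw [finRotate_symm_zero]; simp
    · rw [finRotate_symm_succ]
      simp only [Fin.val_castSucc, Fin.val_succ, Nat.add_sub_cancel]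
      rw [show (l : ℕ) + 1 + n = l + (n + 1) by ring, Nat.add_mod_right, Nat.mod_eq_of_lt (by omega)]

theorem finRotate_symm_val_of_pos {n : ℕ} (i : Fin n) (h : 0 < (i : ℕ)) :
    ((finRotate n).symm i : ℕ) = i - 1 := by
  rw [finRotate_symm_val, show (i : ℕ) + (n - 1) = (i - 1) + n by omega, Nat.add_mod_right,
    Nat.mod_eq_of_lt (by omega)]

/-- The rotation of words as a permutation. -/
def rotatePerm (m d : ℕ) : Equiv.Perm (Word m d) :=
  (finRotate m).arrowCongr (Equiv.refl _)

theorem rotatePerm_apply (u : Word m d) : rotatePerm m d u = u.rotate := rfl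

theorem rotatePerm_pow_apply (r : ℕ) (u : Word m d) :
    (rotatePerm m d ^ r) u = Word.rotate^[r] u := by
  rw [Equiv.Perm.coe_pow]
  rfl

theorem rotatePerm_pow (m d : ℕ) : rotatePerm m d ^ m = 1 := by
  cases m with
  | zero => rfl
  | succ m =>
    have h : ∀ r (u : Word (m + 1) d),
        (rotatePerm (m + 1) d ^ r) u = fun i => u (((finRotate (m + 1)).symm ^ r) i) := by
      intro r
      induction r with
      | zero => intro u; rfl
      | succ r ih =>
        intro u
        rw [pow_succ, Equiv.Perm.mul_apply, ih, pow_succ']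
        rfl
    ext1 u
    rw [h, ← Equiv.Perm.inv_def, inv_pow, finRotate_pow]
    rfl

theorem isPeriodicPt_rotate (u : Word m d) : IsPeriodicPt Word.rotate m u := by
  rw [IsPeriodicPt, IsFixedPt, ← rotatePerm_pow_apply, rotatePerm_pow]
  rfl

theorem mem_periodicPts_rotate (hm : 0 < m) (u : Word m d) :
    u ∈ periodicPts (Word.rotate (m := m) (d := d)) :=
  ⟨m, hm, isPeriodicPt_rotate u⟩

theorem cycleLength_eq (hm : 0 < m) (u : Word m d) :
    u.cycleLength = minimalPeriod Word.rotate u := by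
  have hne : {r | 0 < r ∧ Word.rotate^[r] u = u}.Nonempty := ⟨m, hm, isPeriodicPt_rotate u⟩
  refine le_antisymm (Nat.sInf_le ⟨minimalPeriod_pos_of_mem_periodicPts
    (mem_periodicPts_rotate hm u), iterate_minimalPeriod⟩) ?_
  obtain ⟨h1, h2⟩ := Nat.sInf_mem hne
  exact IsPeriodicPt.minimalPeriod_le h1 h2

theorem cycleFamily_rotate_iterate (r : ℕ) (u : Word m d) :
    Word.cycleFamily (Word.rotate^[r] u) = u.cycleFamily := by
  ext v
  constructor
  · rintro ⟨s, rfl⟩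
    exact ⟨s + r, (iterate_add_apply _ _ _ _).symm⟩
  · rintro ⟨s, rfl⟩
    rcases Nat.eq_zero_or_pos m with rfl | hm
    · exact ⟨0, Subsingleton.elim _ _⟩
    -- Another `(m - 1) * r` rotations undo the first `r`, since `m * r` rotations are trivial.
    refine ⟨s + (m - 1) * r, ?_⟩
    rw [← iterate_add_apply, show s + (m - 1) * r + r = s + m * r by
      obtain ⟨m, rfl⟩ := Nat.exists_eq_succ_of_ne_zero hm.ne'
      simp; ring, iterate_add_apply, ((isPeriodicPt_rotate u).mul_const r).eq]

theorem mem_cycleFamily (u : Word m d) : u ∈ u.cycleFamily := ⟨0, rfl⟩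

/-- The word of length `w` obtained by repeating a word of length `m`. -/
def repeatWord (w : ℕ) (hm : 0 < m) (u : Word m d) : Word w d :=
  fun i => u ⟨i % m, Nat.mod_lt _ hm⟩

theorem repeatWord_injective {w : ℕ} (hm : 0 < m) (h : m ≤ w) :
    Injective (repeatWord (d := d) w hm) := by
  intro u v huv
  funext i
  have := congrFun huv ⟨i, i.2.trans_le h⟩
  simpa [repeatWord, Nat.mod_eq_of_lt i.2] using this

theorem rotate_repeatWord {w : ℕ} (hm : 0 < m) (h : m ∣ w) (u : Word m d) :
    (repeatWord w hm u).rotate = repeatWord w hm u.rotate := by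
  funext i
  simp only [Word.rotate, repeatWord]
  congr 1
  apply Fin.ext
  have hw := i.2
  simp only [finRotate_symm_val]
  rw [Nat.mod_mod_of_dvd _ h]
  obtain ⟨c, rfl⟩ := h
  have hc : 0 < c := Nat.pos_of_ne_zero (by rintro rfl; simp at hw)
  obtain ⟨c, rfl⟩ : ∃ c', c = c' + 1 := ⟨c - 1, by omega⟩
  have e : m * (c + 1) - 1 = m - 1 + m * c := by rw [mul_add, mul_one]; omega
  rw [e, ← add_assoc, Nat.add_mul_mod_self_left, Nat.mod_add_mod]

theorem rotate_iterate_repeatWord {w : ℕ} (hm : 0 < m) (h : m ∣ w) (u : Word m d) (r : ℕ) :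
    Word.rotate^[r] (repeatWord w hm u) = repeatWord w hm (Word.rotate^[r] u) := by
  induction r generalizing u with
  | zero => rfl
  | succ r ih => rw [iterate_succ_apply, iterate_succ_apply, rotate_repeatWord hm h, ih]

theorem minimalPeriod_repeatWord {w : ℕ} (hm : 0 < m) (h : m ∣ w) (hw : 0 < w) (u : Word m d) :
    minimalPeriod Word.rotate (repeatWord w hm u) = minimalPeriod Word.rotate u := by
  rw [minimalPeriod_eq_minimalPeriod_iff]
  intro n
  rw [IsPeriodicPt, IsPeriodicPt, IsFixedPt, IsFixedPt, rotate_iterate_repeatWord hm h,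
    (repeatWord_injective hm (Nat.le_of_dvd hw h)).eq_iff]

theorem rotate_iterate_apply (u : Word m d) (r : ℕ) (i : Fin m) (h : r ≤ i) :
    (Word.rotate^[r] u) i = u ⟨i - r, by omega⟩ := by
  induction r generalizing u with
  | zero => rfl
  | succ r ih =>
    rw [iterate_succ_apply, ih _ (by omega), Word.rotate]
    congr 1
    apply Fin.ext
    rw [finRotate_symm_val_of_pos _ (by simp; omega)]
    simp only
    omega

/-- For `m ≤ i`, rotating `m` times only shifts the index `i` to `i - m`, without wrapping around.
-/
theorem apply_mod_of_isPeriodicPt {w : ℕ} (u : Word w d) (hm : 0 < m)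
    (h : Word.rotate^[m] u = u) (i : ℕ) (hi : i < w) :
    u ⟨i, hi⟩ = u ⟨i % m, (Nat.mod_le _ _).trans_lt hi⟩ := by
  induction i using Nat.strong_induction_on with
  | _ i ih =>
    rcases lt_or_ge i m with him | him
    · simp only [Nat.mod_eq_of_lt him]
    · have h1 := rotate_iterate_apply u m ⟨i, hi⟩ him
      rw [h] at h1
      rw [h1, ih (i - m) (by omega) (by omega)]
      congr 1
      apply Fin.ext
      simp only
      rw [Nat.mod_eq_sub_mod him]

theorem exists_repeatWord_eq {w : ℕ} (hm : 0 < m) (hmw : m ≤ w) (u : Word w d)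
    (h : Word.rotate^[m] u = u) : ∃ v : Word m d, repeatWord w hm v = u :=
  ⟨fun i => u ⟨i, i.2.trans_le hmw⟩, funext fun i =>
    (apply_mod_of_isPeriodicPt u hm h i i.2).symm⟩

/-! ### Parametrization of words by cycle families -/

theorem omega_finite (m d : ℕ) : (omega m d).Finite := Set.toFinite _

instance (m d : ℕ) : Finite (omega m d) := omega_finite m d

/-- The pairs of a divisor `m` of `w` and a cycle family of length and cycle length `m`. -/
abbrev Families (w d : ℕ) : Type := Σ m : {m : ℕ // m ∣ w}, omega m d

/-- A word of length `m` in a cycle family. -/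
def familyWord {m : ℕ} (S : omega m d) : Word m d := S.2.choose

theorem cycleLength_familyWord {m : ℕ} (S : omega m d) : (familyWord S).cycleLength = m :=
  S.2.choose_spec.1

theorem cycleFamily_familyWord {m : ℕ} (S : omega m d) : (familyWord S).cycleFamily = S :=
  S.2.choose_spec.2.symm

variable {w : ℕ} (hw : 0 < w)

/-- The word of length `w` obtained by repeating a word in a cycle family. -/
def familyRep (a : Families w d) : Word w d :=
  repeatWord w (Nat.pos_of_dvd_of_pos a.1.2 hw) (familyWord a.2)

theorem minimalPeriod_familyRep (a : Families w d) :
    minimalPeriod Word.rotate (familyRep hw a) = a.1 := by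
  have hm := Nat.pos_of_dvd_of_pos a.1.2 hw
  rw [familyRep, minimalPeriod_repeatWord hm a.1.2 hw, ← cycleLength_eq hm, cycleLength_familyWord]

/-- The minimal period recovers `m`; injectivity of repetition then brings the equation back to
words of length `m`, whose cycle families must agree. -/
theorem eq_of_rotate_iterate_familyRep {a b : Families w d} {i j : ℕ}
    (h : Word.rotate^[i] (familyRep hw a) = Word.rotate^[j] (familyRep hw b)) : a = b := by
  have h1 := congrArg (minimalPeriod Word.rotate) h
  rw [minimalPeriod_apply_iterate (mem_periodicPts_rotate hw _),
    minimalPeriod_apply_iterate (mem_periodicPts_rotate hw _), minimalPeriod_familyRep,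
    minimalPeriod_familyRep] at h1
  obtain ⟨⟨m, hm⟩, S⟩ := a
  obtain ⟨⟨m', hm'⟩, S'⟩ := b
  obtain rfl : m = m' := h1
  simp only [familyRep] at h
  rw [rotate_iterate_repeatWord _ hm, rotate_iterate_repeatWord _ hm] at h
  have h2 := congrArg Word.cycleFamily
    (repeatWord_injective (Nat.pos_of_dvd_of_pos hm hw) (Nat.le_of_dvd hw hm) h)
  rw [cycleFamily_rotate_iterate, cycleFamily_rotate_iterate, cycleFamily_familyWord,
    cycleFamily_familyWord] at h2
  obtain rfl : S = S' := Subtype.ext h2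
  rfl

/-- A word of period `m` repeats its first `m` letters `v`, and `v` is a rotation of the chosen word
of its family. -/
theorem exists_rotate_iterate_familyRep (u : Word w d) :
    ∃ a : Families w d, ∃ i < (a.1 : ℕ), Word.rotate^[i] (familyRep hw a) = u := by
  have hu := mem_periodicPts_rotate hw u
  set m := minimalPeriod Word.rotate u with hm
  have hm0 : 0 < m := minimalPeriod_pos_of_mem_periodicPts hu
  have hmw : m ∣ w := (isPeriodicPt_rotate u).minimalPeriod_dvd
  obtain ⟨v, hv⟩ := exists_repeatWord_eq hm0 (Nat.le_of_dvd hw hmw) u iterate_minimalPeriod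
  have hvm : v.cycleLength = m := by
    rw [cycleLength_eq hm0, ← minimalPeriod_repeatWord hm0 hmw hw, hv]
  let S : omega m d := ⟨v.cycleFamily, v, hvm, rfl⟩
  obtain ⟨r, hr⟩ : v ∈ (familyWord S).cycleFamily := by
    rw [cycleFamily_familyWord]; exact mem_cycleFamily v
  refine ⟨⟨⟨m, hmw⟩, S⟩, r % m, Nat.mod_lt _ hm0, ?_⟩
  have h := iterate_mod_minimalPeriod_eq (f := Word.rotate) (x := familyWord S) (n := r)
  rw [← cycleLength_eq hm0, cycleLength_familyWord, ← hr] at h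
  rw [familyRep, rotate_iterate_repeatWord _ hmw, ← hv]
  exact congrArg _ h

/-- The decomposition of words into cycles, used both for counting them and for the Tate
computation. -/
theorem rotate_familyRep_bijective :
    Bijective fun x : (Σ a : Families w d, Fin (a.1 : ℕ)) =>
      Word.rotate^[x.2] (familyRep hw x.1) := by
  constructor
  · rintro ⟨a, i⟩ ⟨b, j⟩ h
    obtain rfl := eq_of_rotate_iterate_familyRep hw h
    simp only at h
    rw [iterate_eq_iterate_iff_of_lt_minimalPeriod (by rw [minimalPeriod_familyRep]; exact i.2)
      (by rw [minimalPeriod_familyRep]; exact j.2)] at h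
    rw [Fin.ext h]
  · intro u
    obtain ⟨a, i, hi, h⟩ := exists_rotate_iterate_familyRep hw u
    exact ⟨⟨a, i, hi⟩, h⟩

theorem sum_mul_ncard_omega (hw : 0 < w) (d : ℕ) :
    ∑ m ∈ w.divisors, m * (omega m d).ncard = d ^ w := by
  classical
  have h := Nat.card_eq_of_bijective _ (rotate_familyRep_bijective (d := d) hw)
  have hfin : Finite {m : ℕ // m ∣ w} :=
    Set.Finite.subset (Nat.divisors w).finite_toSet fun m (hm : m ∣ w) => by simp [hm, hw.ne']
  have := Fintype.ofFinite {m : ℕ // m ∣ w}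
  have := fun m => Fintype.ofFinite (omega m d)
  rw [Nat.card_sigma, Nat.card_eq_fintype_card, Fintype.card_fun, Fintype.card_fin,
    Fintype.card_fin] at h
  rw [← h, Finset.sum_subtype (p := fun m => m ∣ w) w.divisors (by simp [hw.ne']),
    Fintype.sum_sigma]
  refine Finset.sum_congr rfl fun m _ => ?_
  simp only [Nat.card_eq_fintype_card, Fintype.card_fin, Finset.sum_const, Finset.card_univ,
    smul_eq_mul]
  rw [← Nat.card_coe_set_eq, Nat.card_eq_fintype_card, mul_comm]

/-- Witt's formula. -/
theorem ncard_omega (hw : 0 < w) (d : ℕ) :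
    ((omega w d).ncard : ℚ) =
      1 / w * ∑ i ∈ w.divisors, (ArithmeticFunction.moebius (w / i) : ℚ) * (d : ℚ) ^ i := by
  have h := (ArithmeticFunction.sum_eq_iff_sum_mul_moebius_eq (R := ℚ)
    (f := fun m => m * (omega m d).ncard) (g := fun n => (d : ℚ) ^ n)).1 (fun n hn => by
      exact_mod_cast sum_mul_ncard_omega hn d) w hw
  rw [Nat.sum_divisorsAntidiagonal' (f := fun i j =>
    (ArithmeticFunction.moebius i : ℚ) * (d : ℚ) ^ j)] at h
  rw [h]
  have : (w : ℚ) ≠ 0 := by exact_mod_cast hw.ne'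
  field_simp

end WordRotation

/-! ### Tate cohomology of a cyclic group with coefficients in a signed permutation module -/

section Tate

variable {X : Type*} (ρ : Equiv.Perm X) (ε : ℤ)

/-- The signed action `f ↦ ε f ∘ ρ` on functions. -/
def twist : (X → ℤ) →ₗ[ℤ] (X → ℤ) := ε • LinearMap.funLeft ℤ ℤ ρ

theorem twist_apply (f : X → ℤ) (x : X) : twist ρ ε f x = ε * f (ρ x) := rfl

theorem twist_pow_apply (i : ℕ) (f : X → ℤ) (x : X) :
    (twist ρ ε ^ i) f x = ε ^ i * f ((ρ ^ i) x) := by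
  induction i generalizing x with
  | zero => simp
  | succ i ih =>
    rw [pow_succ', Module.End.mul_apply, twist_apply, ih, pow_succ' ε, mul_assoc, pow_succ,
      Equiv.Perm.mul_apply]

/-- The norm of the signed action. -/
def twistNorm (w : ℕ) : (X → ℤ) →ₗ[ℤ] (X → ℤ) := ∑ i ∈ Finset.range w, twist ρ ε ^ i

theorem twistNorm_apply (w : ℕ) (f : X → ℤ) (x : X) :
    twistNorm ρ ε w f x = ∑ i ∈ Finset.range w, ε ^ i * f ((ρ ^ i) x) := by
  simp [twistNorm, LinearMap.sum_apply, twist_pow_apply]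

theorem mem_ker_one_sub_twist {f : X → ℤ} :
    f ∈ LinearMap.ker (1 - twist ρ ε) ↔ ∀ x, f x = ε * f (ρ x) := by
  rw [LinearMap.mem_ker, LinearMap.sub_apply, Module.End.one_apply, sub_eq_zero, funext_iff]
  rfl

/-- The signed sum over a cycle of length `m`. -/
def cycleSum (m : ℕ) (x : X) : (X → ℤ) →ₗ[ℤ] ℤ :=
  ∑ i ∈ Finset.range m, ε ^ i • LinearMap.proj ((ρ ^ i) x)

theorem cycleSum_apply (m : ℕ) (x : X) (f : X → ℤ) :
    cycleSum ρ ε m x f = ∑ i ∈ Finset.range m, ε ^ i * f ((ρ ^ i) x) := by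
  simp [cycleSum, LinearMap.sum_apply]

/-- The `m * c` terms form `c` blocks of length `m`, each repeating the first up to a power of `ε ^
m`. -/
theorem twistNorm_mul_apply {m : ℕ} {x : X} (hx : (ρ ^ m) x = x) (c : ℕ) (f : X → ℤ) :
    twistNorm ρ ε (m * c) f x = (∑ j ∈ Finset.range c, (ε ^ m) ^ j) * cycleSum ρ ε m x f := by
  rw [twistNorm_apply, cycleSum_apply]
  induction c with
  | zero => simp
  | succ c ih =>
    rw [mul_add, mul_one, Finset.sum_range_add, ih, Finset.sum_range_succ, add_mul,
      ← eq_sub_iff_add_eq', add_sub_cancel_left, Finset.mul_sum]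
    refine Finset.sum_congr rfl fun i _ => ?_
    have hc : ((ρ ^ m) ^ c) x = x := by
      rw [Equiv.Perm.coe_pow]; exact Function.iterate_fixed hx c
    rw [add_comm (m * c) i, pow_add ρ, Equiv.Perm.mul_apply, pow_mul ρ, hc, pow_add, pow_mul]
    ring

theorem twist_mul_twistNorm {w : ℕ} (hρ : ρ ^ w = 1) (hε : ε ^ w = 1) :
    twist ρ ε * twistNorm ρ ε w = twistNorm ρ ε w := by
  have h1 : twist ρ ε ^ w = 1 := by
    ext f x
    simp [twist_pow_apply, hρ, hε]
  have h := Finset.sum_range_succ (fun i => twist ρ ε ^ i) w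
  rw [Finset.sum_range_succ', h1, pow_zero] at h
  rw [twistNorm, Finset.mul_sum]
  simpa only [pow_succ'] using add_right_cancel h

theorem apply_pow_of_mem_ker (hε : ε = 1 ∨ ε = -1) {f : X → ℤ}
    (hf : f ∈ LinearMap.ker (1 - twist ρ ε)) (i : ℕ) (x : X) : f ((ρ ^ i) x) = ε ^ i * f x := by
  rw [mem_ker_one_sub_twist] at hf
  have hε2 : ε * ε = 1 := by rcases hε with rfl | rfl <;> norm_num
  induction i with
  | zero => simp
  | succ i ih =>
    rw [pow_succ', Equiv.Perm.mul_apply, pow_succ', mul_assoc, ← ih, hf ((ρ ^ i) x), ← mul_assoc,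
      hε2, one_mul]

variable {I : Type*} {m : I → ℕ} {r : I → X} {w : ℕ}

theorem pow_eq_one_or (hε : ε = 1 ∨ ε = -1) (n : ℕ) : ε ^ n = 1 ∨ ε ^ n = -1 := by
  rcases hε with rfl | rfl
  · simp
  · exact neg_one_pow_eq_or ℤ n

theorem exists_fun_eq
    (hE : Function.Bijective fun x : (Σ a : I, Fin (m a)) => (ρ ^ (x.2 : ℕ)) (r x.1))
    (F : I → ℕ → ℤ) : ∃ f : X → ℤ, ∀ a i, i < m a → f ((ρ ^ i) (r a)) = F a i := by
  let E := Equiv.ofBijective _ hE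
  refine ⟨(fun p : (Σ a : I, Fin (m a)) => F p.1 p.2) ∘ E.symm, fun a i hi => ?_⟩
  have : E.symm ((ρ ^ i) (r a)) = ⟨a, i, hi⟩ := by
    rw [Equiv.symm_apply_eq]; rfl
  rw [Function.comp_apply, this]

theorem exists_cycleSum_eq
    (hE : Function.Bijective fun x : (Σ a : I, Fin (m a)) => (ρ ^ (x.2 : ℕ)) (r x.1))
    (hm : ∀ a, 0 < m a) (z : I → ℤ) :
    ∃ f : X → ℤ, ∀ a, cycleSum ρ ε (m a) (r a) f = z a := by
  obtain ⟨f, hf⟩ := exists_fun_eq ρ hE fun a i => if i = 0 then z a else 0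
  refine ⟨f, fun a => ?_⟩
  rw [cycleSum_apply, Finset.sum_eq_single 0]
  · rw [hf a 0 (hm a)]; simp
  · intro i hi hi0
    rw [hf a i (Finset.mem_range.1 hi), if_neg hi0, mul_zero]
  · intro h
    exact absurd (Finset.mem_range.2 (hm a)) h

theorem twistNorm_apply_rep (hper : ∀ a, (ρ ^ m a) (r a) = r a) (hmw : ∀ a, m a ∣ w) (a : I)
    (f : X → ℤ) : twistNorm ρ ε w f (r a) =
      (∑ i ∈ Finset.range (w / m a), (ε ^ m a) ^ i) * cycleSum ρ ε (m a) (r a) f := by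
  rw [← twistNorm_mul_apply ρ ε (hper a), Nat.mul_div_cancel' (hmw a)]

theorem twistNorm_mem_ker (hρ : ρ ^ w = 1) (hεw : ε ^ w = 1) (f : X → ℤ) :
    twistNorm ρ ε w f ∈ LinearMap.ker (1 - twist ρ ε) := by
  rw [LinearMap.mem_ker, LinearMap.sub_apply, Module.End.one_apply, ← Module.End.mul_apply,
    twist_mul_twistNorm ρ ε hρ hεw, sub_self]

theorem eq_of_mem_ker_of_apply_rep
    (hE : Function.Bijective fun x : (Σ a : I, Fin (m a)) => (ρ ^ (x.2 : ℕ)) (r x.1))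
    (hε : ε = 1 ∨ ε = -1) {f g : X → ℤ} (hf : f ∈ LinearMap.ker (1 - twist ρ ε))
    (hg : g ∈ LinearMap.ker (1 - twist ρ ε)) (h : ∀ a, f (r a) = g (r a)) : f = g := by
  funext x
  obtain ⟨⟨a, i⟩, rfl⟩ := hE.2 x
  simp only
  rw [apply_pow_of_mem_ker ρ ε hε hf, apply_pow_of_mem_ker ρ ε hε hg, h]

variable {J : Type*} {j : J → I}

/-- The values of an invariant function at the representatives of the cycles. -/
def invariantValues (m : I → ℕ) (r : I → X) (w : ℕ) (j : J → I) :
    LinearMap.ker (1 - twist ρ ε) →ₗ[ℤ] ((b : J) → ZMod (w / m (j b))) :=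
  LinearMap.pi (fun b =>
    (Int.castAddHom (ZMod (w / m (j b)))).toIntLinearMap ∘ₗ LinearMap.proj (r (j b))) ∘ₗ
    Submodule.subtype _

theorem invariantValues_apply (f : LinearMap.ker (1 - twist ρ ε)) (b : J) :
    invariantValues ρ ε m r w j f b = (((f : X → ℤ) (r (j b)) : ℤ) : ZMod (w / m (j b))) := rfl

theorem invariantValues_surjective
    (hE : Function.Bijective fun x : (Σ a : I, Fin (m a)) => (ρ ^ (x.2 : ℕ)) (r x.1))
    (hper : ∀ a, (ρ ^ m a) (r a) = r a) (hm : ∀ a, 0 < m a) (hε : ε = 1 ∨ ε = -1)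
    (hj : Function.Injective j) (hjr : ∀ b, ε ^ m (j b) = 1) :
    Function.Surjective (invariantValues ρ ε m r w j) := by
  intro y
  -- The value 0 off the image of `j` makes `ε ^ m a * z a = z a` hold for every cycle.
  let z : I → ℤ := Function.extend j (fun b => (y b).cast) 0
  have hz : ∀ a, ε ^ m a * z a = z a := by
    intro a
    by_cases ha : ∃ b, j b = a
    · obtain ⟨b, rfl⟩ := ha
      rw [hjr, one_mul]
    · simp [z, Function.extend_apply' _ _ _ ha]
  obtain ⟨f, hfE⟩ := exists_fun_eq ρ hE fun a i => ε ^ i * z a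
  have h0 : ∀ a, f (r a) = z a := by
    intro a
    simpa using hfE a 0 (hm a)
  have hε2 : ε * ε = 1 := by rcases hε with rfl | rfl <;> norm_num
  have hf : f ∈ LinearMap.ker (1 - twist ρ ε) := by
    rw [mem_ker_one_sub_twist]
    intro x
    obtain ⟨⟨a, i, hi⟩, rfl⟩ := hE.2 x
    simp only
    rw [hfE a i hi, ← Equiv.Perm.mul_apply, ← pow_succ']
    rcases Nat.lt_or_ge (i + 1) (m a) with h | h
    · rw [hfE a _ h, pow_succ', ← mul_assoc, ← mul_assoc, hε2, one_mul]
    -- At the end of a cycle, invariance becomes the closing condition `ε ^ m a * z a = z a`.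
    · have h : i + 1 = m a := by omega
      have hza := hz a
      rw [h, hper, h0]
      rw [← h, pow_succ'] at hza
      linear_combination ε * hza - ε ^ i * z a * hε2
  refine ⟨⟨f, hf⟩, funext fun b => ?_⟩
  rw [invariantValues_apply]
  simp only [h0, z, hj.extend_apply]
  simp

/-- At a representative the norm is a geometric sum in `ε ^ m` times the cycle sum, and cycle sums
can be prescribed freely. The geometric sum is `w / m` if `ε ^ m = 1`; if `ε ^ m = -1`, an invariant
function vanishes on the cycle. -/
theorem mem_ker_invariantValues
    (hE : Function.Bijective fun x : (Σ a : I, Fin (m a)) => (ρ ^ (x.2 : ℕ)) (r x.1))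
    (hper : ∀ a, (ρ ^ m a) (r a) = r a) (hm : ∀ a, 0 < m a) (hε : ε = 1 ∨ ε = -1)
    (hmw : ∀ a, m a ∣ w) (hρ : ρ ^ w = 1) (hεw : ε ^ w = 1)
    (hjr : ∀ a, ε ^ m a = 1 ↔ ∃ b, j b = a) (f : LinearMap.ker (1 - twist ρ ε)) :
    f ∈ LinearMap.ker (invariantValues ρ ε m r w j) ↔
      (f : X → ℤ) ∈ LinearMap.range (twistNorm ρ ε w) := by
  rw [LinearMap.mem_ker]
  constructor
  · intro h
    have h1 : ∀ a, ∃ z : ℤ, (∑ i ∈ Finset.range (w / m a), (ε ^ m a) ^ i) * z =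
        (f : X → ℤ) (r a) := by
      intro a
      by_cases ha : ε ^ m a = 1
      · obtain ⟨b, rfl⟩ := (hjr a).1 ha
        have hb := congrFun h b
        rw [invariantValues_apply, Pi.zero_apply, ZMod.intCast_zmod_eq_zero_iff_dvd] at hb
        obtain ⟨z, hz⟩ := hb
        exact ⟨z, by rw [ha, hz]; simp⟩
      · have ha' : ε ^ m a = -1 := (pow_eq_one_or ε hε _).resolve_left ha
        have h2 := apply_pow_of_mem_ker ρ ε hε f.2 (m a) (r a)
        rw [hper, ha'] at h2
        exact ⟨0, by rw [mul_zero]; omega⟩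
    choose z hz using h1
    obtain ⟨g, hg⟩ := exists_cycleSum_eq ρ ε hE hm z
    refine ⟨g, eq_of_mem_ker_of_apply_rep ρ ε hE hε (twistNorm_mem_ker ρ ε hρ hεw g) f.2
      fun a => ?_⟩
    rw [twistNorm_apply_rep ρ ε hper hmw, hg, hz]
  · rintro ⟨g, hg⟩
    funext b
    rw [invariantValues_apply, Pi.zero_apply, ← hg, twistNorm_apply_rep ρ ε hper hmw,
      (hjr _).2 ⟨b, rfl⟩]
    simp only [one_pow, Finset.sum_const, Finset.card_range, nsmul_eq_mul, mul_one]
    rw [Int.cast_mul, Int.cast_natCast, ZMod.natCast_self, zero_mul]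

/-- The signed sums modulo 2 over the cycles of a function of norm zero. -/
def cycleSums (m : I → ℕ) (r : I → X) (w : ℕ) (j : J → I) :
    LinearMap.ker (twistNorm ρ ε w) →ₗ[ℤ] (J → ZMod 2) :=
  LinearMap.pi (fun b =>
    (Int.castAddHom (ZMod 2)).toIntLinearMap ∘ₗ cycleSum ρ ε (m (j b)) (r (j b))) ∘ₗ
    Submodule.subtype _

theorem cycleSums_apply (f : LinearMap.ker (twistNorm ρ ε w)) (b : J) :
    cycleSums ρ ε m r w j f b = ((cycleSum ρ ε (m (j b)) (r (j b)) f : ℤ) : ZMod 2) := rfl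

/-- The sum telescopes, and the end term returns to `x` with sign `ε ^ n`. -/
theorem cycleSum_one_sub_twist {n : ℕ} {x : X} (hx : (ρ ^ n) x = x)
    (f : X → ℤ) : cycleSum ρ ε n x ((1 - twist ρ ε) f) = (1 - ε ^ n) * f x := by
  have h : ∀ i, ε ^ i * ((1 - twist ρ ε) f) ((ρ ^ i) x) =
      ε ^ i * f ((ρ ^ i) x) - ε ^ (i + 1) * f ((ρ ^ (i + 1)) x) := by
    intro i
    rw [LinearMap.sub_apply, Module.End.one_apply, Pi.sub_apply, twist_apply, pow_succ' ρ,
      Equiv.Perm.mul_apply]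
    ring
  rw [cycleSum_apply, Finset.sum_congr rfl fun i _ => h i,
    Finset.sum_range_sub' (fun i => ε ^ i * f ((ρ ^ i) x)), hx, pow_zero, pow_zero,
    Equiv.Perm.one_apply]
  ring

theorem cycleSums_surjective
    (hE : Function.Bijective fun x : (Σ a : I, Fin (m a)) => (ρ ^ (x.2 : ℕ)) (r x.1))
    (hper : ∀ a, (ρ ^ m a) (r a) = r a) (hm : ∀ a, 0 < m a) (hε : ε = 1 ∨ ε = -1)
    (hmw : ∀ a, m a ∣ w) (hρ : ρ ^ w = 1) (hεw : ε ^ w = 1)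
    (hj : Function.Injective j) (hjr : ∀ b, ε ^ m (j b) = -1) :
    Function.Surjective (cycleSums ρ ε m r w j) := by
  intro y
  let z : I → ℤ := Function.extend j (fun b => (y b).cast) 0
  obtain ⟨f, hf⟩ := exists_cycleSum_eq ρ ε hE hm z
  have hN : f ∈ LinearMap.ker (twistNorm ρ ε w) := by
    refine eq_of_mem_ker_of_apply_rep ρ ε hE hε (twistNorm_mem_ker ρ ε hρ hεw f) (zero_mem _)
      fun a => ?_
    rw [twistNorm_apply_rep ρ ε hper hmw, hf, Pi.zero_apply]
    by_cases ha : ∃ b, j b = a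
    · obtain ⟨b, rfl⟩ := ha
      -- Because `ε ^ w = 1`, the quotient `w / m` is even, so the alternating factor of the norm is
      -- zero.
      have h : (-1 : ℤ) ^ (w / m (j b)) = 1 := by
        rw [← hjr b, ← pow_mul, Nat.mul_div_cancel' (hmw _), hεw]
      rw [hjr, neg_one_geom_sum, if_pos ((neg_one_pow_eq_one_iff_even (by norm_num)).1 h),
        zero_mul]
    · simp [z, Function.extend_apply' _ _ _ ha]
  refine ⟨⟨f, hN⟩, funext fun b => ?_⟩
  rw [cycleSums_apply]
  simp only [hf, z, hj.extend_apply]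
  simp

/-- Along a cycle, `f = (1 - twist) g` is a recursion with a free initial value `c`. It closes up if
`ε ^ m * (c - S) = c`, where `S` is the cycle sum. For `ε ^ m = -1` this asks that `S = 2c`; for `ε
^ m = 1` it asks that `S = 0`, which norm zero gives since `w / m ≠ 0`. -/
theorem mem_ker_cycleSums
    (hE : Function.Bijective fun x : (Σ a : I, Fin (m a)) => (ρ ^ (x.2 : ℕ)) (r x.1))
    (hper : ∀ a, (ρ ^ m a) (r a) = r a) (hm : ∀ a, 0 < m a) (hε : ε = 1 ∨ ε = -1)
    (hmw : ∀ a, m a ∣ w) (hw : 0 < w)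
    (hjr : ∀ a, ε ^ m a = -1 ↔ ∃ b, j b = a) (f : LinearMap.ker (twistNorm ρ ε w)) :
    f ∈ LinearMap.ker (cycleSums ρ ε m r w j) ↔
      (f : X → ℤ) ∈ LinearMap.range (1 - twist ρ ε) := by
  have hε2 : ε * ε = 1 := by rcases hε with rfl | rfl <;> norm_num
  rw [LinearMap.mem_ker]
  constructor
  · intro h
    have h1 : ∀ a, ∃ c : ℤ, ε ^ m a * (c - cycleSum ρ ε (m a) (r a) f) = c := by
      intro a
      by_cases ha : ε ^ m a = -1
      · obtain ⟨b, rfl⟩ := (hjr a).1 ha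
        have hb := congrFun h b
        rw [cycleSums_apply, Pi.zero_apply, ZMod.intCast_zmod_eq_zero_iff_dvd] at hb
        obtain ⟨c, hc⟩ := hb
        exact ⟨c, by rw [ha, hc]; push_cast; ring⟩
      · have ha' : ε ^ m a = 1 := (pow_eq_one_or ε hε _).resolve_right ha
        have h2 := congrFun f.2 (r a)
        rw [twistNorm_apply_rep ρ ε hper hmw, ha'] at h2
        have h3 : (w / m a : ℕ) ≠ 0 :=
          (Nat.div_pos (Nat.le_of_dvd hw (hmw a)) (hm a)).ne'
        simp only [one_pow, Finset.sum_const, Finset.card_range, nsmul_eq_mul, mul_one,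
          Pi.zero_apply, mul_eq_zero, Nat.cast_eq_zero, h3, false_or] at h2
        exact ⟨0, by rw [h2]; simp⟩
    choose c hc using h1
    -- The closed form of the recursion started at `c a`.
    let G : I → ℕ → ℤ := fun a i =>
      ε ^ i * (c a - ∑ l ∈ Finset.range i, ε ^ l * (f : X → ℤ) ((ρ ^ l) (r a)))
    obtain ⟨g, hg⟩ := exists_fun_eq ρ hE G
    have hg' : ∀ a i, i ≤ m a → g ((ρ ^ i) (r a)) = G a i := by
      intro a i hi
      rcases hi.lt_or_eq with h | rfl
      · exact hg a i h
      · have h0 := hg a 0 (hm a)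
        rw [pow_zero, Equiv.Perm.one_apply] at h0
        rw [hper, h0]
        have hca := hc a
        rw [cycleSum_apply] at hca
        simp only [G]
        rw [hca]
        simp
    refine ⟨g, funext fun x => ?_⟩
    obtain ⟨⟨a, i, hi⟩, rfl⟩ := hE.2 x
    simp only
    rw [LinearMap.sub_apply, Module.End.one_apply, Pi.sub_apply, twist_apply,
      ← Equiv.Perm.mul_apply, ← pow_succ', hg' a i hi.le, hg' a (i + 1) hi]
    simp only [G]
    rw [Finset.sum_range_succ]
    have hi2 : ε ^ i * ε ^ i = 1 := by rw [← mul_pow, hε2, one_pow]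
    generalize (∑ l ∈ Finset.range i, ε ^ l * (f : X → ℤ) ((ρ ^ l) (r a))) = S
    generalize (f : X → ℤ) ((ρ ^ i) (r a)) = y
    rw [pow_succ]
    linear_combination (-(ε ^ i) * (c a - S) + ε ^ i * ε ^ i * y) * hε2 + y * hi2
  · rintro ⟨g, hg⟩
    funext b
    rw [cycleSums_apply, Pi.zero_apply, ← hg, cycleSum_one_sub_twist ρ ε (hper _),
      (hjr _).2 ⟨b, rfl⟩, ZMod.intCast_zmod_eq_zero_iff_dvd]
    exact ⟨g (r (j b)), by push_cast; ring⟩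

end Tate

/-! ### The bottom row -/

section BottomRow

variable {d : ℕ}

/-- The tensor `x_{u₁} ⊗ ⋯ ⊗ x_{u_w}` of a word. -/
def wordTensor {w : ℕ} (u : Word w d) : ⨂[ℤ]^w (SqZero ℤ d) :=
  PiTensorProduct.tprod ℤ fun i => mono ℤ d (Finsupp.single (u i) 1)

/-- The tensor with given coordinates on words. -/
def ofWords (w d : ℕ) : (Word w d → ℤ) →ₗ[ℤ] (⨂[ℤ]^w (SqZero ℤ d)) :=
  Fintype.linearCombination ℤ wordTensor

theorem ofWords_apply {w : ℕ} (f : Word w d → ℤ) : ofWords w d f = ∑ u, f u • wordTensor u :=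
  rfl

/-- The coordinate of a tensor at a word. -/
def wordCoord {w : ℕ} (u : Word w d) : (⨂[ℤ]^w (SqZero ℤ d)) →ₗ[ℤ] ℤ :=
  PiTensorProduct.lift ((MultilinearMap.mkPiAlgebra ℤ (Fin w) ℤ).compLinearMap
    fun i => coeffVar ℤ d (u i))

theorem wordCoord_wordTensor {w : ℕ} (u v : Word w d) :
    wordCoord u (wordTensor v) = if u = v then 1 else 0 := by
  rw [wordCoord, wordTensor, PiTensorProduct.lift.tprod]
  simp only [MultilinearMap.compLinearMap_apply, MultilinearMap.mkPiAlgebra_apply,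
    coeffVar_mono_single]
  rw [Finset.prod_ite_zero]
  simp [funext_iff]

theorem ofWords_injective (w d : ℕ) : Function.Injective (ofWords w d) := by
  intro f g h
  funext u
  have h1 := congrArg (wordCoord u) h
  simpa [ofWords_apply, wordCoord_wordTensor] using h1

theorem range_ofWords (w d : ℕ) : LinearMap.range (ofWords w d) = tensorWeight ℤ d w w := by
  refine (Fintype.range_linearCombination ℤ wordTensor).trans (le_antisymm ?_ ?_)
  · rw [Submodule.span_le]
    rintro _ ⟨u, rfl⟩
    exact Submodule.subset_span ⟨fun i => Finsupp.single (u i) 1, by simp, rfl⟩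
  · refine Submodule.span_le.2 ?_
    rintro _ ⟨e, he, rfl⟩
    by_cases h : ∃ i, 2 ≤ (e i).degree
    · obtain ⟨i, hi⟩ := h
      rw [MultilinearMap.map_coord_zero _ i (mono_eq_zero ℤ d hi)]
      exact zero_mem _
    · push Not at h
      -- Here `w` degrees, each at most 1, sum to `w`, so all equal 1.
      have h1 := (Finset.sum_eq_sum_iff_of_le (s := Finset.univ) (f := fun i => (e i).degree)
        (g := fun _ => 1) fun i _ => Nat.lt_succ_iff.1 (h i)).1 (by simp [he])
      have h2 : ∀ i, ∃ j, Finsupp.single j 1 = e i := by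
        intro i
        have : e i ∈ Set.range fun a : Fin d => Finsupp.single a 1 := by
          rw [Finsupp.range_single_one]; exact h1 i (Finset.mem_univ i)
        exact this
      choose u hu using h2
      refine Submodule.subset_span ⟨u, ?_⟩
      simp only [wordTensor, hu]

variable {w' : ℕ}

theorem t_wordTensor (u : Word (w' + 1) d) :
    t ℤ (SqZero ℤ d) w' (wordTensor u) = (-1 : ℤ) ^ w' • wordTensor u.rotate := by
  rw [t, LinearMap.smul_apply, wordTensor, rot_tprod]
  rfl

/-- The sign and the permutation by which `t` acts on the coordinates of the bottom row. -/
abbrev wordTwist (w' d : ℕ) : (Word (w' + 1) d → ℤ) →ₗ[ℤ] (Word (w' + 1) d → ℤ) :=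
  twist (rotatePerm (w' + 1) d)⁻¹ ((-1) ^ w')

/-- Rotating the basis tensors pulls coordinates back along the inverse rotation, hence the inverse
in `wordTwist`. -/
theorem t_ofWords (f : Word (w' + 1) d → ℤ) :
    t ℤ (SqZero ℤ d) w' (ofWords _ d f) = ofWords _ d (wordTwist w' d f) := by
  rw [ofWords_apply, ofWords_apply, map_sum,
    ← Equiv.sum_comp (rotatePerm (w' + 1) d) fun v => wordTwist w' d f v • wordTensor v]
  refine Finset.sum_congr rfl fun u _ => ?_
  rw [map_smul, t_wordTensor, twist_apply, Equiv.Perm.inv_def, Equiv.symm_apply_apply,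
    rotatePerm_apply, smul_smul, mul_comm]

theorem N_ofWords (f : Word (w' + 1) d → ℤ) :
    N ℤ (SqZero ℤ d) w' (ofWords _ d f) =
      ofWords _ d (twistNorm (rotatePerm (w' + 1) d)⁻¹ ((-1) ^ w') (w' + 1) f) := by
  have h : ∀ i, (t ℤ (SqZero ℤ d) w' ^ i) (ofWords _ d f) =
      ofWords _ d ((wordTwist w' d ^ i) f) := by
    intro i
    induction i with
    | zero => rfl
    | succ i ih => rw [pow_succ' (t ℤ (SqZero ℤ d) w'), Module.End.mul_apply, ih, t_ofWords,
        pow_succ' (wordTwist w' d), Module.End.mul_apply]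
  simp only [N, twistNorm, LinearMap.sum_apply, map_sum, h]

/-- The horizontal differential of the bottom row on coordinates. -/
def wordHoriz (w' d : ℕ) (p : ℤ) : (Word (w' + 1) d → ℤ) →ₗ[ℤ] (Word (w' + 1) d → ℤ) :=
  if Even p then twistNorm (rotatePerm (w' + 1) d)⁻¹ ((-1) ^ w') (w' + 1) else 1 - wordTwist w' d

theorem horiz_ofWords (p : ℤ) (f : Word (w' + 1) d → ℤ) :
    horiz ℤ (SqZero ℤ d) p w' (ofWords _ d f) = ofWords _ d (wordHoriz w' d p f) := by
  rw [horiz, wordHoriz]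
  split_ifs
  · exact N_ofWords f
  · rw [LinearMap.sub_apply, LinearMap.sub_apply, map_sub, t_ofWords]
    rfl

/-- The total chain in the bottom row with given coordinates on words. -/
def bottomChain (w' d : ℕ) : (Word (w' + 1) d → ℤ) →ₗ[ℤ] Tot ℤ (SqZero ℤ d) :=
  LinearMap.single ℤ (fun q : ℕ => ⨂[ℤ]^(q + 1) (SqZero ℤ d)) w' ∘ₗ ofWords (w' + 1) d

theorem bottomChain_apply_self (f : Word (w' + 1) d → ℤ) :
    bottomChain w' d f w' = ofWords _ d f :=
  Pi.single_eq_same _ _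

theorem bottomChain_apply_of_ne {q : ℕ} (h : q ≠ w') (f : Word (w' + 1) d → ℤ) :
    bottomChain w' d f q = 0 :=
  Pi.single_eq_of_ne h _

theorem bottomChain_injective : Function.Injective (bottomChain w' d) := by
  intro f g h
  refine ofWords_injective _ d ?_
  rw [← bottomChain_apply_self, h, bottomChain_apply_self]

theorem bottomChain_mem (f : Word (w' + 1) d → ℤ) :
    bottomChain w' d f ∈ totWeight ℤ d (w' + 1) := by
  intro q _
  rcases eq_or_ne q w' with rfl | hq
  · rw [bottomChain_apply_self]
    exact (range_ofWords (q + 1) d).le (LinearMap.mem_range_self _ f)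
  · rw [bottomChain_apply_of_ne hq]
    exact zero_mem _

theorem exists_bottomChain_eq {c : Tot ℤ (SqZero ℤ d)} (hc : c ∈ totWeight ℤ d (w' + 1))
    (h : ∀ q, w' + 1 ≤ q → c q = 0) : ∃ f, bottomChain w' d f = c := by
  have h1 : c w' ∈ tensorWeight ℤ d (w' + 1) (w' + 1) := hc w' trivial
  rw [← range_ofWords] at h1
  obtain ⟨f, hf⟩ := h1
  refine ⟨f, funext fun q => ?_⟩
  rcases lt_trichotomy q w' with hq | rfl | hq
  · rw [bottomChain_apply_of_ne hq.ne]
    exact (eq_zero_of_mem_tensorWeight (by omega) (hc q trivial)).symm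
  · rw [bottomChain_apply_self, hf]
  · rw [bottomChain_apply_of_ne hq.ne', h q hq]

/-- The bottom row is a subcomplex: for weight reasons nothing lies below it. -/
theorem D_bottomChain (n : ℤ) (f : Word (w' + 1) d → ℤ) :
    D ℤ (SqZero ℤ d) n (bottomChain w' d f) = bottomChain w' d (wordHoriz w' d (n - w') f) := by
  funext q
  rcases lt_trichotomy q w' with hq | rfl | hq
  · rw [bottomChain_apply_of_ne hq.ne]
    exact eq_zero_of_mem_tensorWeight (by omega)
      (D_mem_totWeight ℤ d (w' + 1) n _ (bottomChain_mem f) q trivial)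
  · rw [D_apply, bottomChain_apply_self, bottomChain_apply_self,
      bottomChain_apply_of_ne (Nat.succ_ne_self q), map_zero, zero_add, horiz_ofWords]
  · rw [D_apply, bottomChain_apply_of_ne hq.ne', bottomChain_apply_of_ne hq.ne',
      bottomChain_apply_of_ne (by omega), map_zero, map_zero, add_zero]

/-- The cycles of the bottom row as cycles of the total complex. -/
def bottomCycle (w' d : ℕ) (n : ℤ) :
    LinearMap.ker (wordHoriz w' d (n - w')) →ₗ[ℤ] cycles ℤ d (w' + 1) n :=
  LinearMap.codRestrict _ (bottomChain w' d ∘ₗ Submodule.subtype _) fun f =>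
    ⟨bottomChain_mem _, by
      change D ℤ (SqZero ℤ d) n (bottomChain w' d f) = 0
      rw [D_bottomChain, LinearMap.mem_ker.1 f.2, map_zero]⟩

/-- The map from the cycles of the bottom row to homology. -/
def bottomClass (w' d : ℕ) (n : ℤ) :
    LinearMap.ker (wordHoriz w' d (n - w')) →ₗ[ℤ] HPWeight ℤ d (w' + 1) n :=
  Submodule.mkQ _ ∘ₗ bottomCycle w' d n

/-- By acyclicity of the rows above, subtracting a boundary moves any cycle into the bottom row. -/
theorem bottomClass_surjective (n : ℤ) : Function.Surjective (bottomClass w' d n) := by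
  intro y
  obtain ⟨⟨c, hc, hD⟩, rfl⟩ := Submodule.mkQ_surjective _ y
  replace hD : D ℤ (SqZero ℤ d) n c = 0 := hD
  obtain ⟨e, he, h⟩ := exists_D_eq hc fun q _ => congrFun hD q
  have hDe := D_mem_totWeight ℤ d _ (n + 1) e he
  obtain ⟨f, hf⟩ := exists_bottomChain_eq (c := c - D ℤ (SqZero ℤ d) (n + 1) e)
    (sub_mem hc hDe) fun q hq => by rw [Pi.sub_apply, h q hq, sub_self]
  have hfk : f ∈ LinearMap.ker (wordHoriz w' d (n - w')) := by
    refine bottomChain_injective ?_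
    rw [← D_bottomChain, hf, map_sub, hD, D_D, sub_zero, map_zero]
  refine ⟨⟨f, hfk⟩, ?_⟩
  rw [bottomClass, LinearMap.comp_apply, Submodule.mkQ_apply, Submodule.mkQ_apply,
    Submodule.Quotient.eq]
  refine ⟨-e, neg_mem he, ?_⟩
  change _ = bottomChain w' d f - c
  rw [hf, map_neg]
  abel

/-- If `D e` lies in the bottom row, then `e` is a cycle in the quotient by that row, so a boundary
moves `e` itself into the bottom row. -/
theorem mem_ker_bottomClass (n : ℤ) (f : LinearMap.ker (wordHoriz w' d (n - w'))) :
    f ∈ LinearMap.ker (bottomClass w' d n) ↔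
      (f : Word (w' + 1) d → ℤ) ∈ LinearMap.range (wordHoriz w' d (n - w' + 1)) := by
  have hn : n + 1 - (w' : ℤ) = n - w' + 1 := by ring
  rw [LinearMap.mem_ker, bottomClass, LinearMap.comp_apply, Submodule.mkQ_apply,
    Submodule.Quotient.mk_eq_zero]
  change bottomChain w' d f ∈ boundaries ℤ d (w' + 1) n ↔ _
  constructor
  · rintro ⟨e, he, h⟩
    obtain ⟨g, hg, hge⟩ := exists_D_eq (n := n + 1) he fun q hq => by
      rw [h, bottomChain_apply_of_ne (by omega)]
    obtain ⟨y, hy⟩ := exists_bottomChain_eq (c := e - D ℤ (SqZero ℤ d) (n + 1 + 1) g)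
      (sub_mem he (D_mem_totWeight ℤ d _ _ g hg)) fun q hq => by
        rw [Pi.sub_apply, hge q hq, sub_self]
    refine ⟨y, bottomChain_injective ?_⟩
    rw [← hn, ← D_bottomChain, hy, map_sub, D_D, sub_zero, h]
  · rintro ⟨y, hy⟩
    exact ⟨bottomChain w' d y, bottomChain_mem y, by rw [D_bottomChain, hn, hy]⟩

end BottomRow

/-! ### Homology in positive weight -/

section Main

theorem nonempty_linearEquiv_of_ker_eq {R Z M P : Type*} [Ring R] [AddCommGroup Z]
    [AddCommGroup M] [AddCommGroup P] [Module R Z] [Module R M] [Module R P] {f : Z →ₗ[R] M}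
    {g : Z →ₗ[R] P} (hf : Function.Surjective f) (hg : Function.Surjective g)
    (h : LinearMap.ker f = LinearMap.ker g) : Nonempty (M ≃ₗ[R] P) :=
  ⟨(f.quotKerEquivOfSurjective hf).symm ≪≫ₗ Submodule.quotEquivOfEq _ _ h ≪≫ₗ
    g.quotKerEquivOfSurjective hg⟩

variable {d : ℕ} (w' : ℕ)

theorem rotatePerm_inv_pow_familyRep (a : Families (w' + 1) d) :
    ((rotatePerm (w' + 1) d)⁻¹ ^ (a.1 : ℕ)) (familyRep w'.succ_pos a) =
      familyRep w'.succ_pos a := by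
  rw [inv_pow, Equiv.Perm.inv_eq_iff_eq, rotatePerm_pow_apply]
  conv_rhs => rw [← minimalPeriod_familyRep w'.succ_pos a, Function.iterate_minimalPeriod]

theorem rotatePerm_inv_familyRep_bijective :
    Function.Bijective fun x : (Σ a : Families (w' + 1) d, Fin (a.1 : ℕ)) =>
      ((rotatePerm (w' + 1) d)⁻¹ ^ (x.2 : ℕ)) (familyRep w'.succ_pos x.1) := by
  have hb := rotate_familyRep_bijective (d := d) w'.succ_pos
  -- Forward rotations already give a bijection between these finite sets, so injectivity suffices
  -- for backward ones.
  refine (Nat.bijective_iff_injective_and_card _).2 ⟨?_, Nat.card_eq_of_bijective _ hb⟩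
  rintro ⟨a, i⟩ ⟨b, j⟩ h
  simp only at h
  rw [inv_pow, inv_pow, Equiv.Perm.inv_eq_iff_eq, ← Equiv.Perm.mul_apply,
    ((Commute.refl (rotatePerm (w' + 1) d)).pow_pow i j).inv_right.eq, Equiv.Perm.mul_apply,
    Equiv.Perm.eq_inv_iff_eq, rotatePerm_pow_apply, rotatePerm_pow_apply] at h
  obtain rfl := eq_of_rotate_iterate_familyRep w'.succ_pos h
  have := @hb.1 ⟨a, j⟩ ⟨a, i⟩ h
  exact this.symm

theorem rotatePerm_inv_pow : (rotatePerm (w' + 1) d)⁻¹ ^ (w' + 1) = 1 := by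
  rw [inv_pow, rotatePerm_pow, inv_one]

theorem sign_pow : ((-1 : ℤ) ^ w') ^ (w' + 1) = 1 := by
  rw [← pow_mul, (Nat.even_mul_succ_self w').neg_one_pow]

/-- If `w'` is even, the sign is 1 and divisors of the odd number `w' + 1` are odd; if `w'` is odd,
the power is `(-1) ^ m`. -/
theorem sign_pow_eq_one_iff {m : ℕ} (hm : m ∣ w' + 1) :
    ((-1 : ℤ) ^ w') ^ m = 1 ↔ m ≡ w' + 1 [MOD 2] := by
  rw [← pow_mul, neg_one_pow_eq_one_iff_even (by norm_num), Nat.even_mul, Nat.ModEq]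
  have h : w' % 2 = 0 → m % 2 = 1 := by
    intro h
    have := (Nat.odd_iff.2 (show (w' + 1) % 2 = 1 by omega)).of_dvd_nat hm
    exact Nat.odd_iff.1 this
  rw [Nat.even_iff, Nat.even_iff]
  omega

theorem sign_pow_eq_neg_one_iff {m : ℕ} (hm : m ∣ w' + 1) :
    ((-1 : ℤ) ^ w') ^ m = -1 ↔ ¬ m ≡ w' + 1 [MOD 2] := by
  rw [← sign_pow_eq_one_iff w' hm]
  rcases pow_eq_one_or ((-1 : ℤ) ^ w') (neg_one_pow_eq_or ℤ w') m with h | h <;> rw [h] <;> norm_num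

instance (w' : ℕ) (P : ℕ → Prop) : Finite {m : ℕ // m ∣ w' + 1 ∧ P m} :=
  Set.Finite.subset (Nat.divisors (w' + 1)).finite_toSet
    fun m (hm : m ∣ w' + 1 ∧ P m) => by simp [hm.1]

/-- The pairs of a divisor with a given property and a cycle family, among all such pairs. -/
def familiesIncl (P : ℕ → Prop) (x : Σ m : {m : ℕ // m ∣ w' + 1 ∧ P m}, omega m d) :
    Families (w' + 1) d :=
  ⟨⟨x.1, x.1.2.1⟩, x.2⟩

theorem familiesIncl_injective (P : ℕ → Prop) :
    Function.Injective (familiesIncl (d := d) w' P) := by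
  rintro ⟨⟨m, hm⟩, S⟩ ⟨⟨m', hm'⟩, S'⟩ h
  simp only [familiesIncl, Sigma.mk.injEq, Subtype.mk.injEq] at h
  obtain ⟨rfl, h⟩ := h
  obtain rfl := eq_of_heq h
  rfl

theorem exists_familiesIncl_eq (P : ℕ → Prop) (a : Families (w' + 1) d) :
    (∃ b, familiesIncl w' P b = a) ↔ P a.1 := by
  constructor
  · rintro ⟨b, rfl⟩
    exact b.1.2.2
  · intro h
    exact ⟨⟨⟨a.1, a.1.2, h⟩, a.2⟩, rfl⟩

theorem nonempty_pi_linearEquiv (P : ℕ → Prop) (c : ℕ → ℕ) :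
    Nonempty (((b : Σ m : {m : ℕ // m ∣ w' + 1 ∧ P m}, omega m d) → ZMod (c b.1)) ≃ₗ[ℤ]
      ⨁ m : {m : ℕ // m ∣ w' + 1 ∧ P m}, ⨁ _ : omega m d, ZMod (c m)) := by
  classical
  have := Fintype.ofFinite (Σ m : {m : ℕ // m ∣ w' + 1 ∧ P m}, omega m d)
  exact ⟨(DirectSum.linearEquivFunOnFintype ℤ _ _).symm ≪≫ₗ
    DirectSum.sigmaLcurryEquiv ℤ
      (δ := fun (m : {m : ℕ // m ∣ w' + 1 ∧ P m}) (_ : omega m d) => ZMod (c m))⟩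

theorem family_pos (a : Families (w' + 1) d) : 0 < (a.1 : ℕ) :=
  Nat.pos_of_dvd_of_pos a.1.2 w'.succ_pos

/-- Degree `n` meets the bottom row in column `n - w'`. It is odd here, so the homology is `ker (1 -
t) / im N`. -/
theorem nonempty_HPWeight_even (n : ℤ) (hn : ¬ Even (n - w')) :
    Nonempty (HPWeight ℤ d (w' + 1) n ≃ₗ[ℤ]
      ⨁ m : {m : ℕ // m ∣ w' + 1 ∧ m ≡ w' + 1 [MOD 2]},
        ⨁ _ : omega m d, ZMod ((w' + 1) / m)) := by
  have hn' : Even (n - (w' : ℤ) + 1) := by rw [Int.even_add_one]; exact hn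
  have hs := bottomClass_surjective (w' := w') (d := d) n
  have hk := mem_ker_bottomClass (w' := w') (d := d) n
  -- The domain of `bottomClass` depends on the parity of the column; abstracting the map allows
  -- that domain to be rewritten.
  revert hs hk
  generalize bottomClass w' d n = F
  rw [show wordHoriz w' d (n - w' + 1) = _ from if_pos hn']
  revert F
  rw [show wordHoriz w' d (n - w') = _ from if_neg hn]
  intro F hs hk
  have hε := neg_one_pow_eq_or ℤ w'
  obtain ⟨e₁⟩ := nonempty_linearEquiv_of_ker_eq hs
    (invariantValues_surjective (rotatePerm (w' + 1) d)⁻¹ ((-1) ^ w') (w := w' + 1)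
      (j := familiesIncl w' fun m => m ≡ w' + 1 [MOD 2])
      (rotatePerm_inv_familyRep_bijective w') (rotatePerm_inv_pow_familyRep w') (family_pos w') hε
      (familiesIncl_injective w' _) fun b => (sign_pow_eq_one_iff w' b.1.2.1).2 b.1.2.2)
    (Submodule.ext fun f => (hk f).trans (mem_ker_invariantValues (rotatePerm (w' + 1) d)⁻¹ _
      (rotatePerm_inv_familyRep_bijective w') (rotatePerm_inv_pow_familyRep w') (family_pos w') hε
      (fun a => a.1.2) (rotatePerm_inv_pow w') (sign_pow w')
      (fun a => (sign_pow_eq_one_iff w' a.1.2).trans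
        (exists_familiesIncl_eq w' (fun m => m ≡ w' + 1 [MOD 2]) a).symm) f).symm)
  obtain ⟨e₂⟩ := nonempty_pi_linearEquiv (d := d) w' (fun m => m ≡ w' + 1 [MOD 2])
    fun m => (w' + 1) / m
  exact ⟨e₁ ≪≫ₗ e₂⟩

/-- The column `n - w'` is even, so the homology is `ker N / im (1 - t)`. -/
theorem nonempty_HPWeight_odd (n : ℤ) (hn : Even (n - w')) :
    Nonempty (HPWeight ℤ d (w' + 1) n ≃ₗ[ℤ]
      ⨁ m : {m : ℕ // m ∣ w' + 1 ∧ ¬ m ≡ w' + 1 [MOD 2]},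
        ⨁ _ : omega m d, ZMod 2) := by
  have hn' : ¬ Even (n - (w' : ℤ) + 1) := by rw [Int.even_add_one]; simpa using hn
  have hs := bottomClass_surjective (w' := w') (d := d) n
  have hk := mem_ker_bottomClass (w' := w') (d := d) n
  revert hs hk
  generalize bottomClass w' d n = F
  rw [show wordHoriz w' d (n - w' + 1) = _ from if_neg hn']
  revert F
  rw [show wordHoriz w' d (n - w') = _ from if_pos hn]
  intro F hs hk
  have hε := neg_one_pow_eq_or ℤ w'
  obtain ⟨e₁⟩ := nonempty_linearEquiv_of_ker_eq hs
    (cycleSums_surjective (rotatePerm (w' + 1) d)⁻¹ ((-1) ^ w')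
      (j := familiesIncl w' fun m => ¬ m ≡ w' + 1 [MOD 2])
      (rotatePerm_inv_familyRep_bijective w') (rotatePerm_inv_pow_familyRep w') (family_pos w') hε
      (fun a => a.1.2) (rotatePerm_inv_pow w') (sign_pow w')
      (familiesIncl_injective w' _) fun b => (sign_pow_eq_neg_one_iff w' b.1.2.1).2 b.1.2.2)
    (Submodule.ext fun f => (hk f).trans (mem_ker_cycleSums (rotatePerm (w' + 1) d)⁻¹ _
      (rotatePerm_inv_familyRep_bijective w') (rotatePerm_inv_pow_familyRep w') (family_pos w') hε
      (fun a => a.1.2) w'.succ_pos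
      (fun a => (sign_pow_eq_neg_one_iff w' a.1.2).trans
        (exists_familiesIncl_eq w' (fun m => ¬ m ≡ w' + 1 [MOD 2]) a).symm) f).symm)
  obtain ⟨e₂⟩ := nonempty_pi_linearEquiv (d := d) w' (fun m => ¬ m ≡ w' + 1 [MOD 2])
    fun _ => 2
  exact ⟨e₁ ≪≫ₗ e₂⟩

end Main

/-! ### Weight zero -/

section WeightZero

variable {d : ℕ}

/-- The tensor `1 ⊗ ⋯ ⊗ 1`. -/
def oneTensor (d q : ℕ) : ⨂[ℤ]^(q + 1) (SqZero ℤ d) := PiTensorProduct.tprod ℤ fun _ => 1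

theorem exists_smul_oneTensor_eq {q : ℕ} {x} (hx : x ∈ weight ℤ d 0 q) :
    ∃ a : ℤ, a • oneTensor d q = x := by
  rw [← Submodule.mem_span_singleton]
  refine (Submodule.span_le (p := Submodule.span ℤ {oneTensor d q})).2 ?_ hx
  rintro _ ⟨e, he, rfl⟩
  refine Submodule.subset_span ?_
  have h : ∀ i, e i = 0 := by
    intro i
    rw [Finset.sum_eq_zero_iff] at he
    exact (Finsupp.degree_eq_zero_iff _).1 (he i (Finset.mem_univ i))
  simp only [h, mono_zero]
  rfl

theorem smul_oneTensor_mem (a : ℤ) (q : ℕ) : a • oneTensor d q ∈ weight ℤ d 0 q :=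
  Submodule.smul_mem _ _ (Submodule.subset_span ⟨fun _ => 0, by simp, by
    simp only [mono_zero]; rfl⟩)

theorem smul_oneTensor_injective (q : ℕ) : Function.Injective fun a : ℤ => a • oneTensor d q := by
  intro a c h
  have h1 := congrArg (PiTensorProduct.lift
    ((MultilinearMap.mkPiAlgebra ℤ (Fin (q + 1)) ℤ).compLinearMap
      fun _ => (aug ℤ d).toLinearMap)) h
  simpa [oneTensor] using h1

theorem rot_oneTensor (q : ℕ) : rot ℤ (SqZero ℤ d) q (oneTensor d q) = oneTensor d q :=
  rot_tprod _ _ _ _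

theorem face_oneTensor (q : ℕ) (i : Fin (q + 1)) :
    face ℤ (SqZero ℤ d) q i (oneTensor d (q + 1)) = oneTensor d q := by
  rw [oneTensor, face_tprod, oneTensor]
  congr 1
  funext l
  simp [Fin.contractNth]

theorem t_oneTensor (q : ℕ) :
    t ℤ (SqZero ℤ d) q (oneTensor d q) = (-1 : ℤ) ^ q • oneTensor d q := by
  rw [t, LinearMap.smul_apply, rot_oneTensor]

theorem bPrime_oneTensor (q : ℕ) : bPrime ℤ (SqZero ℤ d) q (oneTensor d (q + 1)) =
    (if Even q then (1 : ℤ) else 0) • oneTensor d q := by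
  simp only [bPrime, LinearMap.sum_apply, LinearMap.smul_apply, face_oneTensor]
  rw [← Finset.sum_smul, ← Finset.sum_range (fun i => (-1 : ℤ) ^ i), neg_one_geom_sum]
  simp only [Nat.even_add_one, ite_not]

theorem b_oneTensor (q : ℕ) : b ℤ (SqZero ℤ d) q (oneTensor d (q + 1)) =
    (if Even q then (0 : ℤ) else 1) • oneTensor d q := by
  rw [b, LinearMap.add_apply, bPrime_oneTensor, LinearMap.smul_apply, lastFace,
    LinearMap.comp_apply, rot_oneTensor, face_oneTensor, ← add_smul]
  congr 1
  split_ifs with h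
  · rw [(h.add_one).neg_one_pow]; norm_num
  · rw [(Nat.not_even_iff_odd.1 h).add_one.neg_one_pow]; norm_num

theorem N_oneTensor (q : ℕ) : N ℤ (SqZero ℤ d) q (oneTensor d q) =
    (if Even q then (q + 1 : ℤ) else 0) • oneTensor d q := by
  have h : ∀ i, (t ℤ (SqZero ℤ d) q ^ i) (oneTensor d q) =
      ((-1 : ℤ) ^ q) ^ i • oneTensor d q := by
    intro i
    induction i with
    | zero => simp
    | succ i ih => rw [pow_succ' (t ℤ (SqZero ℤ d) q), Module.End.mul_apply, ih, map_smul,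
        t_oneTensor, smul_smul, ← pow_succ]
  simp only [N, LinearMap.sum_apply, h]
  rw [← Finset.sum_smul]
  congr 1
  split_ifs with hq
  · simp [hq.neg_one_pow]
  · rw [(Nat.not_even_iff_odd.1 hq).neg_one_pow, neg_one_geom_sum, if_pos]
    exact (Nat.not_even_iff_odd.1 hq).add_one

/-- The total chain of weight zero with given coefficients. -/
def unitChain (d : ℕ) (a : ℕ → ℤ) : Tot ℤ (SqZero ℤ d) := fun q => a q • oneTensor d q

theorem unitChain_mem (a : ℕ → ℤ) : unitChain d a ∈ totWeight ℤ d 0 :=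
  fun q _ => smul_oneTensor_mem (a q) q

theorem unitChain_injective : Function.Injective (unitChain d) := by
  intro a c h
  funext q
  exact smul_oneTensor_injective q (congrFun h q)

theorem exists_unitChain_eq {c : Tot ℤ (SqZero ℤ d)} (hc : c ∈ totWeight ℤ d 0) :
    ∃ a, unitChain d a = c := by
  choose a ha using fun q => exists_smul_oneTensor_eq (hc q trivial)
  exact ⟨a, funext ha⟩

theorem D_unitChain_of_odd {n : ℤ} (hn : ¬ Even n) (a : ℕ → ℤ) :
    D ℤ (SqZero ℤ d) n (unitChain d a) = 0 := by
  funext q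
  simp only [D_apply, unitChain, map_smul, vert, horiz, Int.even_sub, Int.even_add_one,
    Int.even_coe_nat, hn, false_iff, not_not, Pi.zero_apply]
  by_cases hq : Even q
  · simp [hq, b_oneTensor, t_oneTensor]
  · simp [hq, bPrime_oneTensor, N_oneTensor]

/-- The coefficients of the differential of a chain of weight zero and even degree. -/
def unitDiff (a : ℕ → ℤ) (q : ℕ) : ℤ :=
  if Even q then (q + 1) * a q - a (q + 1) else 2 * a q + a (q + 1)

theorem D_unitChain_of_even {n : ℤ} (hn : Even n) (a : ℕ → ℤ) :
    D ℤ (SqZero ℤ d) n (unitChain d a) = unitChain d (unitDiff a) := by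
  funext q
  simp only [D_apply, unitChain, map_smul, vert, horiz, Int.even_sub, Int.even_add_one,
    Int.even_coe_nat, hn, true_iff, unitDiff]
  by_cases hq : Even q
  · simp only [hq, not_true_eq_false, if_false, if_true, LinearMap.neg_apply, bPrime_oneTensor,
      N_oneTensor]
    module
  · simp only [hq, not_false_eq_true, if_true, if_false, b_oneTensor, LinearMap.sub_apply,
      t_oneTensor, Module.End.one_apply, (Nat.not_even_iff_odd.1 hq).neg_one_pow]
    module

/-- The coefficient of `a (q + 1)` is `±1`, so the equation is a recursion from any initial value.
Its solution may have infinite support, which the product total complex permits. -/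
theorem exists_unitDiff_eq (z : ℤ) (c : ℕ → ℤ) : ∃ a : ℕ → ℤ, a 0 = z ∧ unitDiff a = c := by
  let a : ℕ → ℤ := fun q => Nat.rec z
    (fun q x => if Even q then (q + 1) * x - c q else c q - 2 * x) q
  have ha : ∀ q, a (q + 1) = if Even q then (q + 1) * a q - c q else c q - 2 * a q := fun _ => rfl
  refine ⟨a, rfl, funext fun q => ?_⟩
  rw [unitDiff, ha]
  split_ifs <;> ring

theorem eq_zero_of_unitDiff_eq_zero {a : ℕ → ℤ} (h0 : a 0 = 0) (h : unitDiff a = 0) : a = 0 := by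
  funext q
  induction q with
  | zero => exact h0
  | succ q ih =>
    have h1 := congrFun h q
    rw [unitDiff, ih] at h1
    split_ifs at h1 <;> simpa using h1

theorem subsingleton_HPWeight_zero {n : ℤ} (hn : Odd n) : Subsingleton (HPWeight ℤ d 0 n) := by
  rw [Submodule.Quotient.subsingleton_iff, eq_top_iff]
  rintro ⟨c, hc, _⟩ _
  obtain ⟨γ, rfl⟩ := exists_unitChain_eq hc
  obtain ⟨a, _, ha⟩ := exists_unitDiff_eq 0 γ
  change unitChain d γ ∈ boundaries ℤ d 0 n
  exact ⟨unitChain d a, unitChain_mem a, by rw [D_unitChain_of_even hn.add_one, ha]⟩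

/-- The incoming differential is zero, and the recursion determines a cycle by its arbitrary
coefficient in row 0. -/
theorem nonempty_HPWeight_zero {n : ℤ} (hn : Even n) : Nonempty (HPWeight ℤ d 0 n ≃ₗ[ℤ] ℤ) := by
  let θ : (⨂[ℤ]^1 (SqZero ℤ d)) →ₗ[ℤ] ℤ := PiTensorProduct.lift
    ((MultilinearMap.mkPiAlgebra ℤ (Fin 1) ℤ).compLinearMap fun _ => (aug ℤ d).toLinearMap)
  have hθ : ∀ a, θ (unitChain d a 0) = a 0 := by
    intro a
    simp [θ, unitChain, oneTensor]
  let g : cycles ℤ d 0 n →ₗ[ℤ] ℤ := θ ∘ₗ LinearMap.proj 0 ∘ₗ Submodule.subtype _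
  have hg : Function.Surjective g := by
    intro z
    obtain ⟨a, h0, ha⟩ := exists_unitDiff_eq z 0
    refine ⟨⟨unitChain d a, unitChain_mem a, ?_⟩, (hθ a).trans h0⟩
    change D ℤ (SqZero ℤ d) n (unitChain d a) = 0
    rw [D_unitChain_of_even hn, ha]
    funext q
    simp [unitChain]
  refine nonempty_linearEquiv_of_ker_eq (Submodule.mkQ_surjective _) hg (Submodule.ext ?_)
  rintro ⟨c, hc, hD⟩
  obtain ⟨a, rfl⟩ := exists_unitChain_eq hc
  rw [Submodule.ker_mkQ, LinearMap.mem_ker]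
  change unitChain d a ∈ boundaries ℤ d 0 n ↔ θ (unitChain d a 0) = 0
  have hz : unitChain d (0 : ℕ → ℤ) = 0 := by
    funext q
    simp [unitChain]
  rw [hθ]
  constructor
  · rintro ⟨e, he, h⟩
    obtain ⟨f, rfl⟩ := exists_unitChain_eq he
    rw [D_unitChain_of_odd (by rw [Int.even_add_one]; simpa using hn)] at h
    rw [← hθ a, ← h]
    simp
  · intro h0
    have hD' : unitDiff a = 0 := by
      refine unitChain_injective (d := d) ?_
      rw [← D_unitChain_of_even hn, hz]
      exact hD
    rw [eq_zero_of_unitDiff_eq_zero h0 hD', hz]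
    exact zero_mem _

end WeightZero

end CyclicHomology

end

theorem mainTheorem6 (d : ℕ) :
    (∀ n : ℤ, Even n → Nonempty (CyclicHomology.HPWeight ℤ d 0 n ≃ₗ[ℤ] ℤ)) ∧
    (∀ n : ℤ, Odd n → Subsingleton (CyclicHomology.HPWeight ℤ d 0 n)) ∧
    (∀ w : ℕ, 0 < w → ∀ i : ℤ,
      Nonempty (CyclicHomology.HPWeight ℤ d w (w + 2 * i) ≃ₗ[ℤ]
        ⨁ m : {m : ℕ // m ∣ w ∧ m ≡ w [MOD 2]},
          ⨁ _ : CyclicHomology.omega m d, ZMod (w / m))) ∧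
    (∀ w : ℕ, 0 < w → ∀ i : ℤ,
      Nonempty (CyclicHomology.HPWeight ℤ d w (w + 1 + 2 * i) ≃ₗ[ℤ]
        ⨁ m : {m : ℕ // m ∣ w ∧ ¬ m ≡ w [MOD 2]},
          ⨁ _ : CyclicHomology.omega m d, ZMod 2)) ∧
    (∀ m : ℕ, 0 < m →
      (CyclicHomology.omega m d).Finite ∧
      ((CyclicHomology.omega m d).ncard : ℚ) =
        1 / m * ∑ i ∈ m.divisors, (ArithmeticFunction.moebius (m / i) : ℚ) * (d : ℚ) ^ i) := by
  refine ⟨fun n hn => CyclicHomology.nonempty_HPWeight_zero hn,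
    fun n hn => CyclicHomology.subsingleton_HPWeight_zero hn, fun w hw i => ?_, fun w hw i => ?_,
    fun m hm => ⟨CyclicHomology.omega_finite m d, CyclicHomology.ncard_omega hm d⟩⟩
  · obtain ⟨w', rfl⟩ : ∃ w', w = w' + 1 := ⟨w - 1, by omega⟩
    refine CyclicHomology.nonempty_HPWeight_even w' _ ?_
    rw [Int.not_even_iff_odd]
    exact ⟨i, by push_cast; ring⟩
  · obtain ⟨w', rfl⟩ : ∃ w', w = w' + 1 := ⟨w - 1, by omega⟩
    refine CyclicHomology.nonempty_HPWeight_odd w' _ ?_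
    exact ⟨i + 1, by push_cast; ring⟩
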